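/- Let $I=\{1,\dots,n\}$ for some $n$, or $I=\mathbb{N}$, and let $K\subset\mathbb{R}^n$ (respectively $K\subset\ell_2$) be a QCO set: $K$ is convex, the set $K^2=\{(\theta_i^2)_{i\in I}:\theta\in K\}$ of entrywise squares is convex, and $K$ is orthosymmetric, i.e. $\theta\in K$ implies $(\pm\theta_i)_{i\in I}\in K$ for every choice of signs. For an integer $k\ge 0$ let $$d_k(K)=\inf_{P}\ \sup_{\theta\in K}\|\theta-P\theta\|_2\in[0,\infty]$$ be the Kolmogorov width, where $P$ ranges over the orthogonal projections onto $k$-dimensional linear subspaces; if $I=\mathbb{N}$, assume that $d_k(K)\to0$ as $k\to\infty$. Let $\sigma>0$, and let $\mathbb{P}_\mu$ be the law of $X=\mu+\xi$, where $\xi_i$, $i\in I$, are i.i.d. $N(0,\sigma^2)$. A level-$\alpha$ test is a measurable function $\phi$ of $X$ with values in $\{0,1\}$ such that $\mathbb{P}_0(\phi=1)\le\alpha$. Put $$\rho(\phi,K,\delta,\sigma)=\inf\Big\{\rho>0:\ \sup_{\mu\in K,\ \|\mu\|_2\ge\rho}\mathbb{P}_\mu(\phi=0)\le\delta\Big\}\in[0,\infty],\qquad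 \rho(K,\alpha,\delta,\sigma)=\inf_{\phi}\rho(\phi,K,\delta,\sigma),$$ where the supremum over an empty set is $0$, the infimum of the empty set is $\infty$, and the last infimum is over all level-$\alpha$ tests $\phi$. There is an absolute constant $c>0$, and for every $\alpha\in(0,1)$ there is $\delta_0=\delta_0(\alpha)>0$, such that for every $\delta\in(0,\delta_0]$ there is a constant $C=C(\alpha,\delta)>0$ for which the following holds for all $I$, $K$ and $\sigma$ as above. (i) If $j^*\in I$, $j^*\ge1$, satisfies $d_{j^*-1}(K)>(j^*)^{1/4}\sigma$ and $d_{j^*}(K)\le(j^*+1)^{1/4}\sigma$, then $$c\,(j^*)^{1/4}\sigma\ \le\ \rho(K,\alpha,\delta,\sigma)\ \le\ C\,(j^*)^{1/4}\sigma .$$ (ii) If $d_0(K)\le\sigma$, then $\rho(K,\alpha,\delta,\sigma)\ge d_0(K)$, so that testing is impossible: for every level-$\alpha$ test $\phi$ and every $0<\rho<d_0(K)$ we have $\sup_{\mu\in K,\ \|\mu\|_2\ge\rho}\mathbb{P}_\mu(\phi=0)>\delta$. -/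

import Mathlib

open MeasureTheory ProbabilityTheory Filter Topology
open scoped ENNReal

/-- The real Hilbert space of square-summable families `(v i)_{i ∈ ι}` with the norm
`‖v‖₂ = (∑ i, v i ^ 2) ^ (1/2)`: it is `ℝⁿ` with the Euclidean norm for `ι = Fin n`,
and `ℓ₂` for `ι = ℕ`. -/
abbrev SeqSpace (ι : Type) : Type := lp (fun _ : ι => ℝ) 2

/-- `K` is orthosymmetric: it is stable under arbitrary changes of the signs of the coordinates. -/
def IsOrthosymmetric {ι : Type} (K : Set (SeqSpace ι)) : Prop :=
  ∀ θ ∈ K, ∀ θ' : SeqSpace ι, (∀ i, θ' i = θ i ∨ θ' i = -θ i) → θ' ∈ K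

/-- `K` is quadratically convex: both `K` and the set `K²` of its entrywise squares are convex. -/
def IsQuadraticallyConvex {ι : Type} (K : Set (SeqSpace ι)) : Prop :=
  Convex ℝ K ∧ Convex ℝ ((fun (θ : SeqSpace ι) (i : ι) => θ i ^ 2) '' K)

/-- `K` is a QCO set: quadratically convex and orthosymmetric. -/
def IsQCO {ι : Type} (K : Set (SeqSpace ι)) : Prop :=
  IsQuadraticallyConvex K ∧ IsOrthosymmetric K

/-- The Kolmogorov width `d_k(K) = inf_P sup_{θ ∈ K} ‖θ - P θ‖₂`, where `P` ranges over the
orthogonal projections on subspaces of dimension `k`; it is `∞` if every such supremum is. -/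
noncomputable def kolmogorovWidth {ι : Type} (K : Set (SeqSpace ι)) (k : ℕ) : ℝ≥0∞ :=
  ⨅ (V : Submodule ℝ (SeqSpace ι)) (_ : FiniteDimensional ℝ V) (_ : Module.finrank ℝ V = k),
    ⨆ θ ∈ K, ENNReal.ofReal ‖θ - V.starProjection θ‖

/-- The law `P_μ` of the observation `X = μ + ξ`, where the `ξ i` are independent `N(0, σ²)`. -/
noncomputable def obsLaw {ι : Type} (σ : ℝ) (μ : SeqSpace ι) : Measure (ι → ℝ) :=
  Measure.infinitePi (fun i => gaussianReal (μ i) (Real.toNNReal (σ ^ 2)))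

/-- `φ` is a level-`α` test of the null hypothesis `μ = 0`; the value `1` means rejection. -/
def IsLevelTest {ι : Type} (α σ : ℝ) (φ : (ι → ℝ) → Fin 2) : Prop :=
  Measurable φ ∧ obsLaw σ (0 : SeqSpace ι) {x | φ x = 1} ≤ ENNReal.ofReal α

/-- The worst-case type II error `sup {P_μ(φ = 0) : μ ∈ K, ‖μ‖₂ ≥ ρ}` of the test `φ`. -/
noncomputable def typeTwoError {ι : Type} (φ : (ι → ℝ) → Fin 2) (K : Set (SeqSpace ι))
    (σ ρ : ℝ) : ℝ≥0∞ :=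
  ⨆ μ ∈ {μ : SeqSpace ι | μ ∈ K ∧ ρ ≤ ‖μ‖}, obsLaw σ μ {x | φ x = 0}

/-- The separation radius `ρ(φ, K, δ, σ)` of the test `φ`: the infimum of the `ρ > 0` at which
the worst-case type II error is at most `δ` (`∞` if there is none). -/
noncomputable def testRadius {ι : Type} (φ : (ι → ℝ) → Fin 2) (K : Set (SeqSpace ι))
    (δ σ : ℝ) : ℝ≥0∞ :=
  ⨅ (ρ : ℝ) (_ : 0 < ρ ∧ typeTwoError φ K σ ρ ≤ ENNReal.ofReal δ), ENNReal.ofReal ρ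

/-- The minimax critical radius `ρ(K, α, δ, σ)`: the infimum of `ρ(φ, K, δ, σ)` over all
level-`α` tests `φ`. -/
noncomputable def criticalRadius {ι : Type} (K : Set (SeqSpace ι)) (α δ σ : ℝ) : ℝ≥0∞ :=
  ⨅ (φ : (ι → ℝ) → Fin 2) (_ : IsLevelTest α σ φ), testRadius φ K δ σ

/-! Upper bound. For a convex orthosymmetric set, a good approximating subspace of dimension `j` can
be traded for at most `2 * j` coordinates, at the price of doubling the squared error
(`exists_coordinate_approx`): averaging over signs removes the off-diagonal part of the projection.
The energy in those coordinates fluctuates by about `√j σ²` under the null. Chebyshev then shows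
that thresholding it detects signals of norm a large multiple of `j^(1/4) σ`.

Lower bound. Take `x ∈ K` with `∑ x i ^ 2` of order `√j σ²` and `∑ x i ^ 4 ≤ σ ^ 4`, and give its
coordinates random signs. If `L` is the likelihood ratio of the mixture, then `E₀[1/L] ≤ exp 10`,
and Cauchy-Schwarz gives `P₀(A)² ≤ exp 10 * Q(A)` for the mixture `Q`. With `A` the acceptance
region, the type II error is at least `(1 - α)² / exp 10`. Bounding `1/L` instead of the chi-square
distance covers every `α < 1` with the same `c`; only `δ₀` depends on `α`.

Such an `x` comes from a minimax argument (`exists_weights_of_sum_min_le`), where convexity of `K²`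
enters. If `∑ min (θ i ^ 2) a` were small for every `θ ∈ K`, one system of weights would witness
this for all `θ` at once, and its heavy coordinates would approximate `K` too well for the width
`d_{j-1}(K)`. In part (ii), any point of norm at most `σ` already has small fourth powers. -/

/-! ### Finitely supported sequences and sign averaging -/

section Sequences

variable {ι : Type}

open Classical in
/-- The sequence with coordinates `x i` for `i ∈ F` and zero elsewhere. -/
noncomputable def finSeq (F : Finset ι) (x : ι → ℝ) : SeqSpace ι :=
  ∑ i ∈ F, lp.single 2 i (x i)

open Classical in
theorem finSeq_apply (F : Finset ι) (x : ι → ℝ) (j : ι) :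
    finSeq F x j = if j ∈ F then x j else 0 := by
  rw [finSeq, lp.coeFn_sum, Finset.sum_apply]
  simp [Pi.single_apply]

theorem hasSum_sq_norm (θ : SeqSpace ι) : HasSum (fun i => θ i ^ 2) (‖θ‖ ^ 2) := by
  have h := lp.hasSum_norm (p := 2) (by norm_num) θ
  simpa using h

theorem sum_sq_le_norm_sq (θ : SeqSpace ι) (F : Finset ι) : ∑ i ∈ F, θ i ^ 2 ≤ ‖θ‖ ^ 2 :=
  sum_le_hasSum F (fun _ _ => sq_nonneg _) (hasSum_sq_norm θ)

theorem norm_sq_finSeq (F : Finset ι) (x : ι → ℝ) : ‖finSeq F x‖ ^ 2 = ∑ i ∈ F, x i ^ 2 := by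
  classical
  refine (hasSum_sq_norm (finSeq F x)).unique ?_
  have : ∑ i ∈ F, x i ^ 2 = ∑ i ∈ F, finSeq F x i ^ 2 :=
    Finset.sum_congr rfl fun i hi => by rw [finSeq_apply, if_pos hi]
  rw [this]
  exact hasSum_sum_of_ne_finset_zero fun i hi => by rw [finSeq_apply, if_neg hi]; norm_num

theorem norm_sub_finSeq_sq (θ : SeqSpace ι) (F : Finset ι) :
    ‖θ - finSeq F θ‖ ^ 2 = ‖θ‖ ^ 2 - ∑ i ∈ F, θ i ^ 2 := by
  classical
  refine (hasSum_sq_norm (θ - finSeq F θ)).unique ?_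
  have h1 := (hasSum_sq_norm θ).sub (hasSum_sq_norm (finSeq F θ))
  rw [norm_sq_finSeq] at h1
  have heq : (fun i => (θ - finSeq F θ) i ^ 2) = fun i => θ i ^ 2 - finSeq F θ i ^ 2 := by
    funext i
    rw [lp.coeFn_sub, Pi.sub_apply, finSeq_apply]
    split_ifs <;> ring
  rw [heq]
  exact h1

/-- Some choice of signs makes the sum of vectors at least as long as in the orthogonal case. -/
theorem exists_signs_sum_norm_sq_le {E : Type*} [NormedAddCommGroup E] [InnerProductSpace ℝ E]
    (u : ι → E) (F : Finset ι) :
    ∃ ε : ι → ℝ, (∀ i, ε i = 1 ∨ ε i = -1) ∧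
      ∑ i ∈ F, ‖u i‖ ^ 2 ≤ ‖∑ i ∈ F, ε i • u i‖ ^ 2 := by
  classical
  induction F using Finset.induction_on with
  | empty => exact ⟨fun _ => 1, fun _ => Or.inl rfl, by simp⟩
  | insert k F hk ih =>
    obtain ⟨ε, hε, hle⟩ := ih
    have hupd : ∀ s : ℝ, ∑ i ∈ insert k F, Function.update ε k s i • u i
        = s • u k + ∑ i ∈ F, ε i • u i := fun s => by
      rw [Finset.sum_insert hk, Function.update_self]
      congr 1
      refine Finset.sum_congr rfl fun i hi => ?_
      rw [Function.update_of_ne (ne_of_mem_of_not_mem hi hk)]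
    have hsgn : ∀ s : ℝ, (s = 1 ∨ s = -1) →
        ∀ i, Function.update ε k s i = 1 ∨ Function.update ε k s i = -1 := fun s hs i => by
      by_cases h : i = k
      · subst h; simpa using hs
      · rw [Function.update_of_ne h]; exact hε i
    -- By the parallelogram law the squared norms for the two signs of the new vector average to the
    -- orthogonal value, so the larger one suffices.
    have hpar := parallelogram_law_with_norm ℝ (∑ i ∈ F, ε i • u i) (u k)
    rw [Finset.sum_insert hk]
    rcases le_total ‖(∑ i ∈ F, ε i • u i) - u k‖ ‖(∑ i ∈ F, ε i • u i) + u k‖ with h | h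
    · refine ⟨Function.update ε k 1, hsgn 1 (Or.inl rfl), ?_⟩
      rw [hupd, one_smul, add_comm (u k)]
      nlinarith [norm_nonneg ((∑ i ∈ F, ε i • u i) - u k)]
    · refine ⟨Function.update ε k (-1), hsgn (-1) (Or.inr rfl), ?_⟩
      rw [hupd, neg_one_smul, add_comm (-u k), ← sub_eq_add_neg]
      nlinarith [norm_nonneg ((∑ i ∈ F, ε i • u i) + u k)]

end Sequences

/-! ### Orthosymmetric sets and coordinate approximation -/

section QCO

variable {ι : Type} {K : Set (SeqSpace ι)}

/-- The truncation is the midpoint of `θ` and its reflection in the coordinates outside `F`. -/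
theorem finSeq_self_mem (hc : Convex ℝ K) (ho : IsOrthosymmetric K) {θ : SeqSpace ι} (hθ : θ ∈ K)
    (F : Finset ι) : finSeq F θ ∈ K := by
  classical
  have hflip : (2 : ℝ) • finSeq F θ - θ ∈ K := ho θ hθ _ fun i => by
    rw [lp.coeFn_sub, Pi.sub_apply, lp.coeFn_smul, Pi.smul_apply, finSeq_apply, smul_eq_mul]
    split_ifs
    · left; ring
    · right; ring
  have := hc hθ hflip (by norm_num : (0 : ℝ) ≤ 1 / 2) (by norm_num : (0 : ℝ) ≤ 1 / 2) (by norm_num)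
  convert this using 1
  module

/-- Convex orthosymmetric sets are solid with respect to finitely supported sequences. -/
theorem finSeq_mem_of_abs_le (hc : Convex ℝ K) (ho : IsOrthosymmetric K) {θ : SeqSpace ι}
    (hθ : θ ∈ K) (F : Finset ι) (x : ι → ℝ) (hx : ∀ i ∈ F, |x i| ≤ |θ i|) : finSeq F x ∈ K := by
  classical
  -- Coordinates are replaced one at a time: `x k` lies between `θ k` and `-θ k`, so the new point
  -- is a convex combination of the old one and its reflection in coordinate `k`.
  have key : ∀ G : Finset ι, G ⊆ F → finSeq F (fun i => if i ∈ G then x i else θ i) ∈ K := by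
    intro G
    induction G using Finset.induction_on with
    | empty => intro _; simpa using finSeq_self_mem hc ho hθ F
    | insert k G hk ih =>
      intro hG
      have hkF : k ∈ F := hG (Finset.mem_insert_self k G)
      have h1 := ih fun i hi => hG (Finset.mem_insert_of_mem hi)
      set η := finSeq F (fun i => if i ∈ G then x i else θ i) with hη
      set η' := finSeq F (fun i => if i = k then -θ i else if i ∈ G then x i else θ i) with hη'
      have h2 : η' ∈ K := ho η h1 _ fun i => by
        rw [hη, hη', finSeq_apply, finSeq_apply]
        by_cases hi : i = k
        · subst hi; simp [hk, hkF]
        · simp [hi]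
      have hxk := abs_le.1 (hx k hkF)
      obtain ⟨r, hr0, hr1, hr⟩ : ∃ r : ℝ, 0 ≤ r ∧ r ≤ 1 ∧ r * θ k + (1 - r) * -θ k = x k := by
        rcases eq_or_ne (θ k) 0 with h0 | h0
        · refine ⟨0, le_rfl, zero_le_one, ?_⟩
          rw [h0] at hxk ⊢
          simp only [abs_zero] at hxk
          linarith
        · have hq : |x k / θ k| ≤ 1 := by
            rw [abs_div]; exact div_le_one_of_le₀ (hx k hkF) (abs_nonneg _)
          have hq' := abs_le.1 hq
          refine ⟨(1 + x k / θ k) / 2, by linarith, by linarith, ?_⟩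
          field_simp
          ring
      have h3 := hc h1 h2 hr0 (sub_nonneg.2 hr1) (by ring)
      convert h3 using 1
      ext i
      rw [lp.coeFn_add, Pi.add_apply, lp.coeFn_smul, lp.coeFn_smul, Pi.smul_apply, Pi.smul_apply,
        hη, hη', finSeq_apply, finSeq_apply, finSeq_apply, smul_eq_mul, smul_eq_mul]
      by_cases hi : i = k
      · subst hi; simp [hkF, hk]; linarith
      · by_cases hiF : i ∈ F
        · simp only [hiF, hi, if_true, if_false, Finset.mem_insert, false_or]; ring
        · simp [hiF]
  have h := key F subset_rfl
  convert h using 1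
  refine Finset.sum_congr rfl fun i hi => ?_
  simp [hi]

theorem norm_starProjection_sq_eq_sum_inner {E : Type*} [NormedAddCommGroup E]
    [InnerProductSpace ℝ E] (V : Submodule ℝ E) [FiniteDimensional ℝ V] (x : E) :
    ‖V.starProjection x‖ ^ 2 = ∑ k, ‖inner ℝ (stdOrthonormalBasis ℝ V k : E) x‖ ^ 2 := by
  rw [Submodule.starProjection_apply, ← Submodule.coe_norm,
    ← (stdOrthonormalBasis ℝ V).sum_sq_norm_inner_right]
  refine Finset.sum_congr rfl fun k _ => ?_
  rw [Submodule.inner_orthogonalProjectionOnto_eq_of_mem_left]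

/-- The left side is a partial sum of the diagonal of the projection, whose trace is the dimension.
-/
theorem sum_norm_starProjection_single_sq_le (V : Submodule ℝ (SeqSpace ι)) [FiniteDimensional ℝ V]
    [DecidableEq ι] (F : Finset ι) :
    ∑ i ∈ F, ‖V.starProjection (lp.single 2 i (1 : ℝ) : SeqSpace ι)‖ ^ 2 ≤ Module.finrank ℝ V := by
  set b := stdOrthonormalBasis ℝ V
  have h1 : ∀ i, ‖V.starProjection (lp.single 2 i (1 : ℝ) : SeqSpace ι)‖ ^ 2
      = ∑ k, (b k : SeqSpace ι) i ^ 2 := fun i => by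
    rw [norm_starProjection_sq_eq_sum_inner]
    refine Finset.sum_congr rfl fun k _ => ?_
    rw [lp.inner_single_right]
    simp [b]
  simp_rw [h1]
  rw [Finset.sum_comm]
  calc ∑ k, ∑ i ∈ F, (b k : SeqSpace ι) i ^ 2 ≤ ∑ _k : Fin (Module.finrank ℝ V), (1 : ℝ) := by
        refine Finset.sum_le_sum fun k _ => (sum_sq_le_norm_sq _ F).trans ?_
        have : ‖(b k : SeqSpace ι)‖ = 1 := b.orthonormal.1 k
        rw [this]; norm_num
    _ = _ := by simp

/-- A subspace approximating `K` can be replaced by a coordinate subspace of at most twice the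
dimension. -/
theorem exists_coordinate_approx (hc : Convex ℝ K) (ho : IsOrthosymmetric K)
    (V : Submodule ℝ (SeqSpace ι)) [FiniteDimensional ℝ V] {D : ℝ}
    (hD : ∀ θ ∈ K, ‖θ - V.starProjection θ‖ ≤ D) :
    ∃ S : Finset ι, S.card ≤ 2 * Module.finrank ℝ V ∧
      ∀ θ ∈ K, ‖θ‖ ^ 2 ≤ ∑ i ∈ S, θ i ^ 2 + 2 * D ^ 2 := by
  classical
  set e : ι → SeqSpace ι := fun i => lp.single 2 i (1 : ℝ) with he
  set w : ι → ℝ := fun i => ‖V.starProjection (e i)‖ ^ 2 with hw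
  have hw0 : ∀ i, 0 ≤ w i := fun i => sq_nonneg _
  have hwF : ∀ F : Finset ι, ∑ i ∈ F, w i ≤ Module.finrank ℝ V :=
    fun F => sum_norm_starProjection_single_sq_le V F
  have hcard : ∀ F : Finset ι, (∀ i ∈ F, 1 / 2 ≤ w i) → F.card ≤ 2 * Module.finrank ℝ V := by
    intro F hF
    have h1 := Finset.card_nsmul_le_sum F w (1 / 2) hF
    have h2 := h1.trans (hwF F)
    rw [nsmul_eq_mul] at h2
    have : (F.card : ℝ) ≤ 2 * Module.finrank ℝ V := by linarith
    exact_mod_cast this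
  have hfin : {i | 1 / 2 ≤ w i}.Finite := by
    by_contra hinf
    obtain ⟨F, hF, hFc⟩ := Set.Infinite.exists_subset_card_eq hinf (2 * Module.finrank ℝ V + 1)
    have := hcard F fun i hi => hF hi
    omega
  refine ⟨hfin.toFinset, hcard _ fun i hi => by simpa using hi, fun θ hθ => ?_⟩
  refine hasSum_le_of_sum_le (hasSum_sq_norm θ) fun F => ?_
  -- A suitable sign change of the truncated `θ` stays in `K`, and its residual is at least as long
  -- as if the residuals of the basis vectors were orthogonal.
  have hres : ∑ i ∈ F, θ i ^ 2 * (1 - w i) ≤ D ^ 2 := by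
    obtain ⟨ε, hε, hle⟩ := exists_signs_sum_norm_sq_le
      (fun i => θ i • (e i - V.starProjection (e i))) F
    have hn : ∀ i, ‖e i - V.starProjection (e i)‖ ^ 2 = 1 - w i := fun i => by
      have h1 := V.norm_sq_eq_add_norm_sq_starProjection (e i)
      rw [Submodule.starProjection_orthogonal_val] at h1
      have h2 : ‖e i‖ = 1 := by rw [he]; simp [lp.norm_single]
      rw [h2] at h1
      simp only [hw]; linarith
    have hmem : finSeq F (fun i => ε i * θ i) ∈ K := by
      refine finSeq_mem_of_abs_le hc ho hθ F _ fun i _ => ?_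
      rcases hε i with h | h <;> simp [h]
    have heq : ∑ i ∈ F, ε i • θ i • (e i - V.starProjection (e i))
        = finSeq F (fun i => ε i * θ i) - V.starProjection (finSeq F (fun i => ε i * θ i)) := by
      have hs : finSeq F (fun i => ε i * θ i) = ∑ i ∈ F, (ε i * θ i) • e i := by
        refine Finset.sum_congr rfl fun i _ => ?_
        ext j
        simp [he, Pi.single_apply]
      rw [hs, map_sum, ← Finset.sum_sub_distrib]
      refine Finset.sum_congr rfl fun i _ => ?_
      rw [map_smul, smul_smul, smul_sub]
    rw [heq] at hle
    calc ∑ i ∈ F, θ i ^ 2 * (1 - w i) = ∑ i ∈ F, ‖θ i • (e i - V.starProjection (e i))‖ ^ 2 := by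
          refine Finset.sum_congr rfl fun i _ => ?_
          rw [norm_smul, mul_pow, hn, Real.norm_eq_abs, sq_abs]
      _ ≤ _ := hle
      _ ≤ D ^ 2 := pow_le_pow_left₀ (norm_nonneg _) (hD _ hmem) 2
  have hw1 : ∀ i, w i ≤ 1 := fun i => by
    have h2 : ‖e i‖ = 1 := by rw [he]; simp [lp.norm_single]
    have := V.norm_starProjection_apply_le (e i)
    rw [h2] at this
    exact pow_le_one₀ (norm_nonneg _) this
  -- Outside the chosen set `1 - w i > 1 / 2`, hence the factor 2.
  have hpt : ∀ i ∈ F, θ i ^ 2 ≤ (if i ∈ hfin.toFinset then θ i ^ 2 else 0)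
      + 2 * (θ i ^ 2 * (1 - w i)) := fun i _ => by
    have h0 := sq_nonneg (θ i)
    have h1 := mul_nonneg h0 (sub_nonneg.2 (hw1 i))
    split_ifs with hi
    · linarith
    · have : w i < 1 / 2 := by simpa using hi
      nlinarith
  calc ∑ i ∈ F, θ i ^ 2 ≤ ∑ i ∈ F, ((if i ∈ hfin.toFinset then θ i ^ 2 else 0)
      + 2 * (θ i ^ 2 * (1 - w i))) := Finset.sum_le_sum hpt
    _ = ∑ i ∈ F, (if i ∈ hfin.toFinset then θ i ^ 2 else 0)
      + 2 * ∑ i ∈ F, θ i ^ 2 * (1 - w i) := by rw [Finset.sum_add_distrib, Finset.mul_sum]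
    _ ≤ _ := by
      refine add_le_add ?_ (by linarith)
      rw [← Finset.sum_filter]
      refine Finset.sum_le_sum_of_subset_of_nonneg (fun i hi => (Finset.mem_filter.1 hi).2)
        fun i _ _ => sq_nonneg _

/-- Coordinate subspaces bound the Kolmogorov width. -/
theorem kolmogorovWidth_le_of_coordinate (S : Finset ι) {D : ℝ} (hD0 : 0 ≤ D)
    (h : ∀ θ ∈ K, ‖θ‖ ^ 2 ≤ ∑ i ∈ S, θ i ^ 2 + D ^ 2) :
    kolmogorovWidth K S.card ≤ ENNReal.ofReal D := by
  classical
  have hon : Orthonormal ℝ (fun i : S => (lp.single 2 (i : ι) (1 : ℝ) : SeqSpace ι)) := by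
    rw [orthonormal_iff_ite]
    intro i j
    rw [lp.inner_single_left, lp.single_apply, Pi.single_apply]
    by_cases hij : i = j
    · simp [hij]
    · simp [hij]
  set V := Submodule.span ℝ (Set.range fun i : S => (lp.single 2 (i : ι) (1 : ℝ) : SeqSpace ι))
    with hV
  have hfd : FiniteDimensional ℝ V := FiniteDimensional.span_of_finite ℝ (Set.finite_range _)
  have hrank : Module.finrank ℝ V = S.card := by
    rw [hV, finrank_span_eq_card hon.linearIndependent, Fintype.card_coe]
  refine iInf_le_of_le V (iInf_le_of_le hfd (iInf_le_of_le hrank ?_))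
  refine iSup₂_le fun θ hθ => ENNReal.ofReal_le_ofReal ?_
  have hmem : finSeq S θ ∈ V := Submodule.sum_mem _ fun i hi => by
    have : (lp.single 2 i (θ i) : SeqSpace ι) = θ i • lp.single 2 i (1 : ℝ) := by
      ext j; simp [Pi.single_apply]
    rw [this]
    exact V.smul_mem _ (Submodule.subset_span ⟨⟨i, hi⟩, rfl⟩)
  have h1 : ‖θ - V.starProjection θ‖ ≤ ‖θ - finSeq S θ‖ := by
    rw [Submodule.starProjection_minimal]
    exact ciInf_le ⟨0, by rintro _ ⟨x, rfl⟩; exact norm_nonneg _⟩ (⟨_, hmem⟩ : V)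
  refine h1.trans (abs_le_of_sq_le_sq' ?_ hD0).2
  rw [norm_sub_finSeq_sq]
  linarith [h θ hθ]

theorem kolmogorovWidth_zero : kolmogorovWidth K 0 = ⨆ θ ∈ K, ENNReal.ofReal ‖θ‖ := by
  refine le_antisymm ?_ (le_iInf fun V => le_iInf fun _ => le_iInf fun hV => ?_)
  · refine iInf_le_of_le ⊥ (iInf_le_of_le inferInstance (iInf_le_of_le (by simp) ?_))
    simp
  · obtain rfl := Submodule.finrank_eq_zero.1 hV
    simp

end QCO

/-! ### A minimax argument by separation -/

section Minimax

/-- If every point of a convex set `T` has small truncated sum, then a single choice of weights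
realises this bound for all points of `T`. -/
theorem exists_weights_of_sum_min_le {κ : Type*} [Fintype κ] {T : Set (κ → ℝ)} (hT : Convex ℝ T)
    {a s : ℝ} (h : ∀ t ∈ T, ∑ i, min (t i) a ≤ s) :
    ∃ w : κ → ℝ, (∀ i, 0 ≤ w i ∧ w i ≤ 1) ∧ ∀ t ∈ T, ∑ i, (t i * (1 - w i) + a * w i) ≤ s := by
  classical
  set W : Set (κ → ℝ) := Set.Icc 0 1 with hW
  set f : (κ → ℝ) → (κ → ℝ) → ℝ := fun t w => ∑ i, (t i * (1 - w i) + a * w i) with hf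
  have hcont : ∀ t, Continuous (f t) := fun t => by simp only [hf]; fun_prop
  have hWc : IsCompact W := by rw [hW]; exact isCompact_Icc
  -- Since `min (t i) a` is the minimum of `t i * (1 - w i) + a * w i` over `w i ∈ [0, 1]`, the
  -- claim exchanges a supremum over `t` and a minimum over `w`. Compactness of `W` reduces it to
  -- finitely many `t`.
  suffices hne : (W ∩ ⋂ t : T, {w | f t w ≤ s}).Nonempty by
    obtain ⟨w, hw, hw'⟩ := hne
    exact ⟨w, fun i => ⟨hw.1 i, hw.2 i⟩, fun t ht => Set.mem_iInter.1 hw' ⟨t, ht⟩⟩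
  refine hWc.inter_iInter_nonempty _ (fun t => isClosed_le (hcont t) continuous_const) fun u => ?_
  by_contra hemp
  have hno : ∀ w ∈ W, ∃ t ∈ u, s < f t w := by
    intro w hw
    by_contra! hcon
    exact hemp ⟨w, hw, by simpa using hcon⟩
  set G : (κ → ℝ) → (u → ℝ) := fun w t => f t w - s with hG
  have hGc : Continuous G := continuous_pi fun t => (hcont t).sub continuous_const
  have hGW : IsCompact (G '' W) := hWc.image hGc
  have hGconv : Convex ℝ (G '' W) := by
    rintro _ ⟨w, hw, rfl⟩ _ ⟨w', hw', rfl⟩ p q hp hq hpq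
    refine ⟨p • w + q • w', convex_Icc (0 : κ → ℝ) 1 hw hw' hp hq hpq, ?_⟩
    funext t
    simp only [hG, hf, Pi.add_apply, Pi.smul_apply, smul_eq_mul]
    rw [mul_sub, mul_sub, Finset.mul_sum, Finset.mul_sum]
    have h1 : p * s + q * s = s := by rw [← add_mul, hpq, one_mul]
    rw [sub_add_sub_comm, h1, ← Finset.sum_add_distrib]
    congr 1
    refine Finset.sum_congr rfl fun i _ => ?_
    have : q = 1 - p := by linarith
    subst this; ring
  have hdisj : Disjoint (G '' W) (Set.Iic (0 : u → ℝ)) := by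
    rw [Set.disjoint_left]
    rintro _ ⟨w, hw, rfl⟩ hle
    obtain ⟨t, htu, ht⟩ := hno w hw
    have := hle ⟨t, htu⟩
    simp only [hG, Pi.zero_apply] at this
    linarith
  -- If no `w` serves all `t ∈ u`, the convex compact set of excess vectors misses the negative
  -- orthant. The separating functional is `-∑ c t * x t` with `c ≥ 0`, because it is bounded below
  -- on the orthant.
  obtain ⟨ℓ, p, q, hp, hpq, hq⟩ := geometric_hahn_banach_compact_closed hGconv hGW
    (convex_Iic (0 : u → ℝ)) isClosed_Iic hdisj
  have hq0 : q < 0 := by simpa using hq 0 (Set.mem_Iic.2 le_rfl)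
  set c : u → ℝ := fun t => -ℓ (Pi.single t 1) with hcdef
  have hc0 : ∀ t, 0 ≤ c t := by
    intro t
    by_contra! hneg
    have hpos : 0 < ℓ (Pi.single t 1) := by simp only [hcdef] at hneg; linarith
    have h1 := hq ((q / ℓ (Pi.single t 1)) • Pi.single t (1 : ℝ)) (by
      intro t'
      rw [Pi.smul_apply, Pi.single_apply, smul_eq_mul]
      split_ifs
      · simpa using (div_neg_of_neg_of_pos hq0 hpos).le
      · simp)
    rw [map_smul, smul_eq_mul, div_mul_cancel₀ _ hpos.ne'] at h1
    exact lt_irrefl _ h1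
  have hℓ : ∀ x : u → ℝ, ℓ x = -∑ t, c t * x t := by
    intro x
    conv_lhs => rw [← Finset.univ_sum_single x]
    rw [map_sum, ← Finset.sum_neg_distrib]
    refine Finset.sum_congr rfl fun t _ => ?_
    have : (Pi.single t (x t) : u → ℝ) = x t • Pi.single t (1 : ℝ) := by
      rw [← Pi.single_smul]; simp
    rw [this, map_smul, smul_eq_mul]; simp only [hcdef]; ring
  have hpos : ∀ w ∈ W, 0 < ∑ t, c t * (f t w - s) := fun w hw => by
    have h1 := hp _ ⟨w, hw, rfl⟩
    rw [hℓ] at h1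
    have : ∑ t, c t * G w t = ∑ t, c t * (f t w - s) := rfl
    linarith
  have hsum : 0 < ∑ t, c t := by
    refine lt_of_le_of_ne (Finset.sum_nonneg fun t _ => hc0 t) fun h0 => ?_
    have hz := (Finset.sum_eq_zero_iff_of_nonneg fun t _ => hc0 t).1 h0.symm
    have h1 := hpos 0 ⟨le_rfl, zero_le_one⟩
    rw [Finset.sum_eq_zero fun t ht => by rw [hz t ht, zero_mul]] at h1
    exact lt_irrefl _ h1
  -- The normalised `c` mixes the points of `u` into a single point of `T`. The best response to it,
  -- `w = 1` exactly where `a < m i`, attains the truncated sum and contradicts `hpos`.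
  set m : κ → ℝ := ∑ t : u, (c t / ∑ t, c t) • ((t : T) : κ → ℝ) with hm
  have hmT : m ∈ T := hT.sum_mem (fun t _ => div_nonneg (hc0 t) hsum.le)
    (by rw [← Finset.sum_div, div_self hsum.ne']) fun t _ => (t : T).2
  set w : κ → ℝ := fun i => if a < m i then 1 else 0
  have hwW : w ∈ W := ⟨fun i => by simp only [w]; split_ifs <;> simp,
    fun i => by simp only [w]; split_ifs <;> simp⟩
  have hfm : f m w ≤ s := by
    refine le_of_eq_of_le (Finset.sum_congr rfl fun i _ => ?_) (h m hmT)
    simp only [w]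
    split_ifs with hi
    · rw [min_eq_right hi.le]; ring
    · rw [min_eq_left (not_lt.1 hi)]; ring
  have hlin : (∑ t, c t) * f m w = ∑ t : u, c t * f t w := by
    simp only [hf, Finset.mul_sum]
    rw [Finset.sum_comm]
    refine Finset.sum_congr rfl fun i _ => ?_
    have hmi : (∑ t, c t) * m i = ∑ t : u, c t * (t : T).1 i := by
      rw [hm, Finset.sum_apply, Finset.mul_sum]
      refine Finset.sum_congr rfl fun t _ => ?_
      rw [Pi.smul_apply, smul_eq_mul]
      field_simp
    calc (∑ t, c t) * (m i * (1 - w i) + a * w i)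
        = ((∑ t, c t) * m i) * (1 - w i) + (∑ t, c t) * (a * w i) := by ring
      _ = _ := by
        rw [hmi, Finset.sum_mul, Finset.sum_mul, ← Finset.sum_add_distrib]
        exact Finset.sum_congr rfl fun t _ => by ring
  have h1 := hpos w hwW
  simp only [mul_sub] at h1
  rw [Finset.sum_sub_distrib, ← hlin, ← Finset.sum_mul, ← mul_sub] at h1
  nlinarith

end Minimax

/-! ### Least favourable points -/

section Weights

variable {ι : Type} {K : Set (SeqSpace ι)}

/-- If a quadratically convex set is not approximated to accuracy `j a` by any `j - 1`
coordinates, it contains a point with large truncated sum of squares. -/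
theorem exists_sum_min_sq_ge (hK : Convex ℝ ((fun (θ : SeqSpace ι) (i : ι) => θ i ^ 2) '' K))
    {j : ℕ} (hj : 1 ≤ j) {a : ℝ} (ha : 0 < a)
    (hfar : ∀ S : Finset ι, S.card < j → ∃ θ ∈ K, ∑ i ∈ S, θ i ^ 2 + j * a < ‖θ‖ ^ 2)
    (F : Finset ι) (hF : ∀ θ ∈ K, ‖θ‖ ^ 2 ≤ ∑ i ∈ F, θ i ^ 2 + j * a / 4) :
    ∃ θ ∈ K, j * a / 4 ≤ ∑ i ∈ F, min (θ i ^ 2) a := by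
  classical
  by_contra! hcon
  have hj0 : (0 : ℝ) < j := by exact_mod_cast hj
  set T : Set (F → ℝ) := (fun x : ι → ℝ => fun i : F => x i) ''
    ((fun (θ : SeqSpace ι) (i : ι) => θ i ^ 2) '' K) with hTdef
  have hT : Convex ℝ T := hK.is_linear_image ⟨fun _ _ => rfl, fun _ _ => rfl⟩
  obtain ⟨w, hw, hwT⟩ := exists_weights_of_sum_min_le (a := a) (s := j * a / 4) hT (by
    rintro _ ⟨_, ⟨θ, hθ, rfl⟩, rfl⟩
    have := (hcon θ hθ).le
    rwa [← Finset.sum_coe_sort] at this)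
  have hwK : ∀ θ ∈ K, ∑ i : F, (θ i ^ 2 * (1 - w i) + a * w i) ≤ j * a / 4 :=
    fun θ hθ => hwT _ ⟨_, ⟨θ, hθ, rfl⟩, rfl⟩
  set S' : Finset F := Finset.univ.filter fun i => 1 / 2 ≤ w i with hS'
  have hcard : S'.card < j := by
    -- Only the existence of some point of `K` is needed: it gives `∑ w i ≤ j / 4`, so at most `j /
    -- 2` weights reach `1 / 2`.
    obtain ⟨θ, hθ, -⟩ := hfar ∅ (by rw [Finset.card_empty]; omega)
    have h1 : ∑ i : F, a * w i ≤ j * a / 4 := le_trans (Finset.sum_le_sum fun i _ => by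
      nlinarith [sq_nonneg (θ i), (hw i).2]) (hwK θ hθ)
    have h2 : (S'.card : ℝ) * (1 / 2) ≤ ∑ i : F, w i := by
      rw [← nsmul_eq_mul]
      refine (Finset.card_nsmul_le_sum S' w (1 / 2) fun i hi => (Finset.mem_filter.1 hi).2).trans ?_
      exact Finset.sum_le_sum_of_subset_of_nonneg (Finset.subset_univ _) fun i _ _ => (hw i).1
    rw [← Finset.mul_sum] at h1
    have h3 : a * ∑ i : F, w i ≤ a * (j / 4) := by linarith
    have h4 := le_of_mul_le_mul_left h3 ha
    have : (S'.card : ℝ) < j := by linarith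
    exact_mod_cast this
  obtain ⟨θ, hθ, hlt⟩ := hfar (S'.map (Function.Embedding.subtype _)) (by rwa [Finset.card_map])
  rw [Finset.sum_map] at hlt
  -- The light coordinates of `F` carry at most `j * a / 2` and those outside `F` at most `j * a /
  -- 4`; the total is below `j * a`, against `hfar`.
  have h1 : ∑ i ∈ F, θ i ^ 2 ≤ ∑ i ∈ S', θ i ^ 2 + 2 * (j * a / 4) := by
    have hle := hwK θ hθ
    rw [← Finset.sum_coe_sort]
    have hpt : ∀ i : F, θ i ^ 2 ≤ (if 1 / 2 ≤ w i then θ i ^ 2 else 0)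
        + 2 * (θ i ^ 2 * (1 - w i) + a * w i) := fun i => by
      have h0 := sq_nonneg (θ i)
      have h1 := mul_nonneg h0 (sub_nonneg.2 (hw i).2)
      have h2 := mul_nonneg ha.le (hw i).1
      split_ifs with hi
      · linarith
      · have := not_le.1 hi
        nlinarith
    refine (Finset.sum_le_sum fun i _ => hpt i).trans ?_
    rw [Finset.sum_add_distrib, ← Finset.mul_sum, ← Finset.sum_filter]
    linarith
  have h2 := hF θ hθ
  simp only [Function.Embedding.subtype_apply] at hlt
  nlinarith [mul_pos hj0 ha]

theorem exists_approx_of_kolmogorovWidth_lt (hc : Convex ℝ K) (ho : IsOrthosymmetric K) {k : ℕ}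
    {D : ℝ} (hD : 0 ≤ D) (h : kolmogorovWidth K k < ENNReal.ofReal D) :
    ∃ S : Finset ι, S.card ≤ 2 * k ∧ ∀ θ ∈ K, ‖θ‖ ^ 2 ≤ ∑ i ∈ S, θ i ^ 2 + 2 * D ^ 2 := by
  simp only [kolmogorovWidth, iInf_lt_iff] at h
  obtain ⟨V, hV, rfl, hlt⟩ := h
  refine exists_coordinate_approx hc ho V fun θ hθ => ?_
  have h1 := (le_iSup₂_of_le (f := fun θ (_ : θ ∈ K) => ENNReal.ofReal ‖θ - V.starProjection θ‖)
    θ hθ le_rfl).trans hlt.le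
  exact (ENNReal.ofReal_le_ofReal_iff hD).1 h1

theorem exists_finset_approx (hc : Convex ℝ K) (ho : IsOrthosymmetric K)
    (hlim : Infinite ι → Tendsto (fun k : ℕ => kolmogorovWidth K k) atTop (𝓝 0)) {η : ℝ}
    (hη : 0 < η) : ∃ F : Finset ι, ∀ θ ∈ K, ‖θ‖ ^ 2 ≤ ∑ i ∈ F, θ i ^ 2 + η := by
  rcases finite_or_infinite ι with hfin | hinf
  · have := Fintype.ofFinite ι
    refine ⟨Finset.univ, fun θ _ => ?_⟩
    have h1 := (hasSum_sq_norm θ).unique (hasSum_fintype _)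
    linarith
  · have hs : 0 < Real.sqrt (η / 2) := Real.sqrt_pos.2 (by linarith)
    obtain ⟨k, hk⟩ := ((hlim hinf).eventually
      (gt_mem_nhds (ENNReal.ofReal_pos.2 hs))).exists
    obtain ⟨F, -, hF⟩ := exists_approx_of_kolmogorovWidth_lt hc ho hs.le hk
    refine ⟨F, fun θ hθ => (hF θ hθ).trans ?_⟩
    rw [Real.sq_sqrt (by linarith)]
    linarith

/-- The width involves subspaces of dimension exactly `j - 1`, so `S` is first enlarged to `j - 1`
coordinates; `hcard` makes room for this. -/
theorem exists_far_of_lt_kolmogorovWidth {j : ℕ} (hj : 1 ≤ j) (hcard : (j : ℕ∞) ≤ ENat.card ι)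
    {D : ℝ} (hD : 0 ≤ D) (h : ENNReal.ofReal D < kolmogorovWidth K (j - 1)) (S : Finset ι)
    (hS : S.card < j) : ∃ θ ∈ K, ∑ i ∈ S, θ i ^ 2 + D ^ 2 < ‖θ‖ ^ 2 := by
  by_contra! hcon
  obtain ⟨S', hSS', hS'⟩ : ∃ S' : Finset ι, S ⊆ S' ∧ S'.card = j - 1 := by
    rcases finite_or_infinite ι with hfin | hinf
    · have := Fintype.ofFinite ι
      refine Finset.exists_superset_card_eq (by omega) ?_
      rw [ENat.card_eq_coe_fintype_card] at hcard
      have : j ≤ Fintype.card ι := by exact_mod_cast hcard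
      omega
    · exact Infinite.exists_superset_card_eq S _ (by omega)
  have h1 := kolmogorovWidth_le_of_coordinate (K := K) S' hD fun θ hθ =>
    (hcon θ hθ).trans (by
      gcongr)
  rw [hS'] at h1
  exact absurd h (not_lt.2 h1)

/-- The least favourable points: a finitely supported `x` in `K` with small fourth powers and
`∑ x i ^ 2` of the order of `√j σ²`. -/
theorem exists_least_favourable (hK : IsQCO K)
    (hlim : Infinite ι → Tendsto (fun k : ℕ => kolmogorovWidth K k) atTop (𝓝 0))
    {j : ℕ} (hj : 1 ≤ j) (hcard : (j : ℕ∞) ≤ ENat.card ι) {σ : ℝ} (hσ : 0 < σ)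
    (h : ENNReal.ofReal ((j : ℝ) ^ (1 / 4 : ℝ) * σ) < kolmogorovWidth K (j - 1)) :
    ∃ (F : Finset ι) (x : ι → ℝ), (finSeq F x) ∈ K ∧
      ∑ i ∈ F, x i ^ 2 = (1 / 2 * ((j : ℝ) ^ (1 / 4 : ℝ) * σ)) ^ 2 ∧
      ∑ i ∈ F, x i ^ 4 ≤ σ ^ 4 := by
  have hj0 : (0 : ℝ) < j := by exact_mod_cast hj
  set r : ℝ := (j : ℝ) ^ (1 / 4 : ℝ) with hr
  have hr0 : 0 < r := Real.rpow_pos_of_pos hj0 _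
  have hr4 : r ^ 4 = j := by
    rw [hr, ← Real.rpow_natCast, ← Real.rpow_mul hj0.le]; norm_num
  -- With this level `j * a = (r * σ) ^ 2`, the squared width bound, while `a * (j * a) = σ ^ 4`
  -- controls the fourth powers.
  set a : ℝ := σ ^ 2 / r ^ 2 with ha
  have ha0 : 0 < a := by positivity
  have hja : j * a = (r * σ) ^ 2 := by rw [ha, ← hr4]; field_simp
  obtain ⟨F, hF⟩ := exists_finset_approx hK.1.1 hK.2 hlim (η := j * a / 4) (by positivity)
  obtain ⟨θ, hθ, hge⟩ := exists_sum_min_sq_ge hK.1.2 hj ha0 (fun S hS => by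
    rw [hja]
    exact exists_far_of_lt_kolmogorovWidth hj hcard (by positivity) h S hS) F hF
  set M := ∑ i ∈ F, min (θ i ^ 2) a with hM
  have hM0 : 0 < M := lt_of_lt_of_le (by positivity) hge
  -- Shrinking by `l ≤ 1` makes the sum of squares exactly `j * a / 4` and keeps the point below
  -- `|θ|`, hence in `K`.
  set l : ℝ := j * a / 4 / M with hl
  have hl0 : 0 ≤ l := by positivity
  have hl1 : l ≤ 1 := (div_le_one hM0).2 hge
  have hmin0 : ∀ i, 0 ≤ min (θ i ^ 2) a := fun i => le_min (sq_nonneg _) ha0.le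
  have hsq : ∀ i, Real.sqrt (l * min (θ i ^ 2) a) ^ 2 = l * min (θ i ^ 2) a :=
    fun i => Real.sq_sqrt (mul_nonneg hl0 (hmin0 i))
  have hsum : ∑ i ∈ F, Real.sqrt (l * min (θ i ^ 2) a) ^ 2 = j * a / 4 := by
    simp_rw [hsq]
    rw [← Finset.mul_sum, ← hM, hl, div_mul_cancel₀ _ hM0.ne']
  refine ⟨F, fun i => Real.sqrt (l * min (θ i ^ 2) a), ?_, ?_, ?_⟩
  · refine finSeq_mem_of_abs_le hK.1.1 hK.2 hθ F _ fun i _ => ?_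
    rw [abs_of_nonneg (Real.sqrt_nonneg _)]
    refine Real.sqrt_le_iff.2 ⟨abs_nonneg _, ?_⟩
    rw [sq_abs]
    exact (mul_le_of_le_one_left (hmin0 i) hl1).trans (min_le_left _ _)
  · rw [hsum, hja]; ring
  · calc ∑ i ∈ F, Real.sqrt (l * min (θ i ^ 2) a) ^ 4
        ≤ ∑ i ∈ F, a * Real.sqrt (l * min (θ i ^ 2) a) ^ 2 := by
          refine Finset.sum_le_sum fun i _ => ?_
          have h1 : Real.sqrt (l * min (θ i ^ 2) a) ^ 2 ≤ a := by
            rw [hsq]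
            exact (mul_le_of_le_one_left (hmin0 i) hl1).trans (min_le_right _ _)
          nlinarith [sq_nonneg (Real.sqrt (l * min (θ i ^ 2) a))]
      _ = a * (j * a / 4) := by rw [← Finset.mul_sum, hsum]
      _ = σ ^ 4 / 4 := by rw [ha, ← hr4]; field_simp
      _ ≤ σ ^ 4 := by linarith [pow_pos hσ 4]

end Weights

/-! ### Likelihood ratios of symmetric Gaussian mixtures -/

section LikelihoodRatio

/-- The density of a product measure with respect to another one from which it differs in finitely
many coordinates. -/
theorem infinitePi_eq_withDensity_prod {ι : Type*} {μ ν : ι → Measure ℝ}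
    [∀ i, IsProbabilityMeasure (μ i)] [∀ i, IsProbabilityMeasure (ν i)] (F : Finset ι)
    {f : ι → ℝ → ℝ≥0∞} (hf : ∀ i, Measurable (f i))
    (hF : ∀ i ∈ F, ν i = (μ i).withDensity (f i)) (hF' : ∀ i ∉ F, ν i = μ i) :
    Measure.infinitePi ν
      = (Measure.infinitePi μ).withDensity fun x => ∏ i ∈ F, f i (x i) := by
  classical
  -- It suffices to compare on boxes, where indicator times density is a product of functions of
  -- independent coordinates.
  refine (Measure.eq_infinitePi ν fun s t ht => ?_).symm
  have hbox : MeasurableSet (Set.pi (s : Set ι) t) :=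
    MeasurableSet.pi s.countable_toSet fun i _ => ht i
  set h : ι → ℝ → ℝ≥0∞ := fun i y =>
    (if i ∈ s then (t i).indicator 1 y else 1) * (if i ∈ F then f i y else 1) with hh
  have hhm : ∀ i, Measurable (h i) := fun i => by
    have h1 : Measurable fun y => (t i).indicator (1 : ℝ → ℝ≥0∞) y :=
      measurable_one.indicator (ht i)
    by_cases hi : i ∈ s <;> by_cases hi' : i ∈ F <;>
      simp only [hh, hi, hi', if_true, if_false, mul_one, one_mul]
    exacts [h1.mul (hf i), h1, hf i, measurable_const]
  have hprod : ∀ x : ι → ℝ, (Set.pi (s : Set ι) t).indicator (fun x => ∏ i ∈ F, f i (x i)) x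
      = ∏ i ∈ s ∪ F, h i (x i) := fun x => by
    simp only [hh]
    rw [Finset.prod_mul_distrib, Finset.prod_ite_mem, Finset.prod_ite_mem,
      Finset.inter_eq_right.2 Finset.subset_union_left,
      Finset.inter_eq_right.2 Finset.subset_union_right]
    by_cases hx : x ∈ Set.pi (s : Set ι) t
    · have h1 : ∏ i ∈ s, (t i).indicator (1 : ℝ → ℝ≥0∞) (x i) = 1 :=
        Finset.prod_eq_one fun i hi => by rw [Set.indicator_of_mem (hx i hi), Pi.one_apply]
      rw [Set.indicator_of_mem hx, h1, one_mul]
    · rw [Set.indicator_of_notMem hx]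
      simp only [Set.mem_pi, not_forall] at hx
      obtain ⟨i, hi, hxi⟩ := hx
      rw [Finset.prod_eq_zero hi (Set.indicator_of_notMem hxi _), zero_mul]
  have hmarg : ∀ i, ∫⁻ y, h i y ∂μ i = if i ∈ s then ν i (t i) else 1 := fun i => by
    simp only [hh]
    by_cases hi : i ∈ F
    · simp only [hi, if_true, hF i hi]
      split_ifs with his
      · rw [withDensity_apply _ (ht i), ← lintegral_indicator (ht i)]
        refine lintegral_congr fun y => ?_
        by_cases hy : y ∈ t i <;> simp [hy]
      · have := measure_univ (μ := ν i)
        rw [hF i hi, withDensity_apply _ .univ, setLIntegral_univ] at this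
        simpa using this
    · simp only [hi, if_false, hF' i hi, mul_one]
      split_ifs with his
      · exact lintegral_indicator_one (ht i)
      · simp
  rw [withDensity_apply _ hbox, ← lintegral_indicator hbox]
  simp_rw [hprod]
  have hind := lintegral_prod_eq_prod_lintegral_of_indepFun (μ := Measure.infinitePi μ) (s ∪ F)
    (fun i x => h i (x i)) (iIndepFun_infinitePi hhm) fun i => (hhm i).comp (measurable_pi_apply i)
  rw [hind]
  have hint : ∀ i, ∫⁻ x, h i (x i) ∂Measure.infinitePi μ = ∫⁻ y, h i y ∂μ i := fun i =>
    (measurePreserving_eval_infinitePi μ i).lintegral_comp (hhm i)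
  simp_rw [hint, hmarg]
  rw [Finset.prod_ite_mem, Finset.inter_eq_right.2 Finset.subset_union_left]

theorem gaussianReal_eq_withDensity_exp {σ : ℝ} (hσ : 0 < σ) (m : ℝ) :
    gaussianReal m (Real.toNNReal (σ ^ 2)) = (gaussianReal 0 (Real.toNNReal (σ ^ 2))).withDensity
      fun x => ENNReal.ofReal (Real.exp (m * x / σ ^ 2 - m ^ 2 / (2 * σ ^ 2))) := by
  have hv : Real.toNNReal (σ ^ 2) ≠ 0 := by
    rw [Ne, Real.toNNReal_eq_zero, not_le]; positivity
  have hvc : ((Real.toNNReal (σ ^ 2) : NNReal) : ℝ) = σ ^ 2 := Real.coe_toNNReal _ (sq_nonneg _)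
  rw [gaussianReal_of_var_ne_zero _ hv, gaussianReal_of_var_ne_zero _ hv,
    ← withDensity_mul _ (measurable_gaussianPDF _ _) (by fun_prop)]
  congr 1
  funext x
  rw [Pi.mul_apply, gaussianPDF, gaussianPDF, ← ENNReal.ofReal_mul (gaussianPDFReal_nonneg _ _ _),
    gaussianPDFReal, gaussianPDFReal, hvc, mul_assoc (√_)⁻¹, ← Real.exp_add]
  congr 3
  field_simp
  ring

/-- The density of `(N(m, σ²) + N(-m, σ²)) / 2` with respect to `N(0, σ²)`. -/
noncomputable def symmDensity (σ m x : ℝ) : ℝ :=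
  Real.exp (-(m ^ 2 / (2 * σ ^ 2))) * Real.cosh (m * x / σ ^ 2)

theorem symmDensity_pos (σ m x : ℝ) : 0 < symmDensity σ m x :=
  mul_pos (Real.exp_pos _) (Real.cosh_pos _)

theorem measurable_symmDensity (σ m : ℝ) : Measurable (symmDensity σ m) := by
  unfold symmDensity; fun_prop

theorem integral_exp_mul_gaussianReal {σ : ℝ} (s : ℝ) :
    ∫ x, Real.exp (s * x) ∂gaussianReal 0 (Real.toNNReal (σ ^ 2)) = Real.exp (σ ^ 2 * s ^ 2 / 2) := by
  have h := congrFun (mgf_fun_id_gaussianReal (μ := 0) (v := Real.toNNReal (σ ^ 2))) s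
  rw [mgf, Real.coe_toNNReal _ (sq_nonneg _)] at h
  rw [h]; ring_nf

/-- With `c = cosh`, `c * (3 - 3 * c + c ^ 2) - 1 = (c - 1) ^ 3 ≥ 0` bounds `1 / c` by a polynomial
with explicit Gaussian integral. This bound is sharp enough at `c = 1` that the terms of order `m ^
2` cancel and only `m ^ 4` remains. -/
theorem lintegral_inv_symmDensity_le {σ : ℝ} (hσ : 0 < σ) {m : ℝ} (hm : m ^ 4 ≤ σ ^ 4) :
    ∫⁻ x, ENNReal.ofReal (symmDensity σ m x)⁻¹ ∂gaussianReal 0 (Real.toNNReal (σ ^ 2))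
      ≤ ENNReal.ofReal (Real.exp (10 * (m ^ 4 / σ ^ 4))) := by
  set t := m ^ 2 / σ ^ 2 with ht
  have ht0 : 0 ≤ t := by positivity
  have ht1 : t ≤ 1 := by
    refine (div_le_one (by positivity)).2 ?_
    refine (abs_le_of_sq_le_sq' ?_ (by positivity)).2
    nlinarith
  set s := m / σ ^ 2 with hs
  set y := Real.exp (t / 2) with hy
  have hst : σ ^ 2 * s ^ 2 = t := by rw [hs, ht]; field_simp
  set b : ℝ → ℝ := fun x => y * (7 / 2 - 3 / 2 * (Real.exp (s * x) + Real.exp (-s * x))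
    + 1 / 4 * (Real.exp (2 * s * x) + Real.exp (-(2 * s) * x))) with hb
  have hpt : ∀ x, (symmDensity σ m x)⁻¹ ≤ b x := fun x => by
    have h1 : (symmDensity σ m x)⁻¹ = y * (Real.cosh (s * x))⁻¹ := by
      rw [symmDensity, mul_inv, ← Real.exp_neg, neg_neg]
      congr 2
      · rw [ht]; field_simp
      · rw [hs]; ring_nf
    rw [h1]
    refine mul_le_mul_of_nonneg_left ?_ (Real.exp_pos _).le
    have hc := Real.one_le_cosh (s * x)
    have h2 : 7 / 2 - 3 / 2 * (Real.exp (s * x) + Real.exp (-s * x))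
        + 1 / 4 * (Real.exp (2 * s * x) + Real.exp (-(2 * s) * x))
        = 3 - 3 * Real.cosh (s * x) + Real.cosh (s * x) ^ 2 := by
      have e1 : Real.exp (2 * s * x) = Real.exp (s * x) ^ 2 := by
        rw [← Real.exp_nat_mul]; ring_nf
      have e2 : Real.exp (-(2 * s) * x) = Real.exp (-s * x) ^ 2 := by
        rw [← Real.exp_nat_mul]; ring_nf
      have e3 : Real.exp (s * x) * Real.exp (-s * x) = 1 := by
        rw [← Real.exp_add]; simp
      rw [e1, e2, Real.cosh_eq, ← neg_mul]
      linear_combination (-1 / 2) * e3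
    rw [h2, inv_le_iff_one_le_mul₀ (by linarith)]
    nlinarith [pow_nonneg (sub_nonneg.2 hc) 3]
  have hint : ∀ c : ℝ, Integrable (fun x => Real.exp (c * x))
      (gaussianReal 0 (Real.toNNReal (σ ^ 2))) := fun c => integrable_exp_mul_gaussianReal c
  have hbint : Integrable b (gaussianReal 0 (Real.toNNReal (σ ^ 2))) :=
    (((integrable_const _).sub (((hint _).add (hint _)).const_mul _)).add
      (((hint _).add (hint _)).const_mul _)).const_mul _
  have hbval : ∫ x, b x ∂gaussianReal 0 (Real.toNNReal (σ ^ 2))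
      = y * (7 / 2 - 3 * y + 1 / 2 * y ^ 4) := by
    have e4 : Real.exp (2 * t) = y ^ 4 := by rw [hy, ← Real.exp_nat_mul]; ring_nf
    simp only [hb]
    rw [integral_const_mul, integral_add, integral_sub, integral_const_mul, integral_const_mul,
      integral_add (hint _) (hint _), integral_add (hint _) (hint _), integral_const]
    · simp only [integral_exp_mul_gaussianReal]
      have e1 : σ ^ 2 * s ^ 2 / 2 = t / 2 := by rw [hst]
      have e2 : σ ^ 2 * (-s) ^ 2 / 2 = t / 2 := by rw [neg_sq, hst]
      have e3 : σ ^ 2 * (2 * s) ^ 2 / 2 = 2 * t := by rw [← hst]; ring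
      have e3' : σ ^ 2 * (-(2 * s)) ^ 2 / 2 = 2 * t := by rw [← hst]; ring
      rw [e1, e2, e3, e3', e4, ← hy]
      simp only [probReal_univ, one_smul]
      ring
    · exact integrable_const _
    · exact ((hint _).add (hint _)).const_mul _
    · exact (integrable_const _).sub (((hint _).add (hint _)).const_mul _)
    · exact ((hint _).add (hint _)).const_mul _
  have hb0 : ∀ x, 0 ≤ b x := fun x => (inv_pos.2 (symmDensity_pos σ m x)).le.trans (hpt x)
  calc ∫⁻ x, ENNReal.ofReal (symmDensity σ m x)⁻¹ ∂gaussianReal 0 (Real.toNNReal (σ ^ 2))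
      ≤ ∫⁻ x, ENNReal.ofReal (b x) ∂gaussianReal 0 (Real.toNNReal (σ ^ 2)) :=
        lintegral_mono fun x => ENNReal.ofReal_le_ofReal (hpt x)
    _ = ENNReal.ofReal (y * (7 / 2 - 3 * y + 1 / 2 * y ^ 4)) := by
        rw [← hbval, ofReal_integral_eq_lintegral_ofReal hbint (ae_of_all _ hb0)]
    _ ≤ _ := by
        refine ENNReal.ofReal_le_ofReal ?_
        have hy1 : 1 ≤ y := Real.one_le_exp (by linarith)
        have hyt : y ≤ 1 + t := by
          have h1 := Real.abs_exp_sub_one_le (x := t / 2) (by rw [abs_le]; constructor <;> linarith)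
          rw [abs_le, abs_of_nonneg (by linarith : (0 : ℝ) ≤ t / 2)] at h1
          linarith [h1.2]
        -- The double root at `y = 1` yields the order `t ^ 2`; the cofactor at `y = 2` is the
        -- constant 10.
        have h2 : y * (7 / 2 - 3 * y + 1 / 2 * y ^ 4)
            = 1 + (y - 1) ^ 2 * (y ^ 3 / 2 + y ^ 2 + 3 / 2 * y - 1) := by ring
        have hy2 : y ≤ 2 := by linarith
        have h3 : y ^ 3 / 2 + y ^ 2 + 3 / 2 * y - 1 ≤ 10 := by
          have := pow_le_pow_left₀ (by linarith) hy2 3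
          have := pow_le_pow_left₀ (by linarith) hy2 2
          linarith
        have h4 : (y - 1) ^ 2 ≤ t ^ 2 := pow_le_pow_left₀ (by linarith) (by linarith) 2
        have h5 : m ^ 4 / σ ^ 4 = t ^ 2 := by rw [ht]; field_simp
        rw [h2, h5]
        refine le_trans ?_ (Real.add_one_le_exp _)
        nlinarith [sq_nonneg (y - 1)]

end LikelihoodRatio

/-! ### The lower bound through random signs -/

section LowerBound

variable {ι : Type}

instance (σ : ℝ) (μ : SeqSpace ι) : IsProbabilityMeasure (obsLaw σ μ) := by
  unfold obsLaw; infer_instance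

theorem ofReal_exp_add_ofReal_exp_neg (σ m y : ℝ) :
    ENNReal.ofReal (Real.exp (m * y / σ ^ 2 - m ^ 2 / (2 * σ ^ 2)))
      + ENNReal.ofReal (Real.exp (-m * y / σ ^ 2 - (-m) ^ 2 / (2 * σ ^ 2)))
      = 2 * ENNReal.ofReal (symmDensity σ m y) := by
  rw [← ENNReal.ofReal_add (Real.exp_pos _).le (Real.exp_pos _).le,
    ← ENNReal.ofReal_ofNat 2, ← ENNReal.ofReal_mul zero_le_two]
  congr 1
  rw [symmDensity, Real.cosh_eq, neg_sq, sub_eq_add_neg, sub_eq_add_neg, Real.exp_add,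
    Real.exp_add, neg_mul, neg_div]
  ring

/-- Some choice of signs makes the probability of `A` at least its probability under the mixture
over all signs. -/
theorem exists_signs_lintegral_symmDensity_le {σ : ℝ} (hσ : 0 < σ) (F : Finset ι) (x : ι → ℝ)
    {A : Set (ι → ℝ)} (hA : MeasurableSet A) :
    ∃ ε : ι → ℝ, (∀ i, ε i = 1 ∨ ε i = -1) ∧
      ∫⁻ y in A, ∏ i ∈ F, ENNReal.ofReal (symmDensity σ (x i) (y i)) ∂obsLaw σ (0 : SeqSpace ι)
        ≤ obsLaw σ (finSeq F fun i => ε i * x i) A := by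
  classical
  set I := ∫⁻ y in A, ∏ i ∈ F, ENNReal.ofReal (symmDensity σ (x i) (y i))
    ∂obsLaw σ (0 : SeqSpace ι) with hI
  set sg : Finset ι → ι → ℝ := fun t i => if i ∈ t then 1 else -1 with hsg
  set f : ℝ → ℝ → ℝ≥0∞ := fun m y =>
    ENNReal.ofReal (Real.exp (m * y / σ ^ 2 - m ^ 2 / (2 * σ ^ 2))) with hf
  have hfm : ∀ m, Measurable (f m) := fun m => by simp only [hf]; fun_prop
  have hdens : ∀ t, obsLaw σ (finSeq F fun i => sg t i * x i) A
      = ∫⁻ y in A, ∏ i ∈ F, f (sg t i * x i) (y i) ∂obsLaw σ (0 : SeqSpace ι) := fun t => by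
    unfold obsLaw
    rw [infinitePi_eq_withDensity_prod (μ := fun i => gaussianReal ((0 : SeqSpace ι) i) _) F
      (f := fun i => f (sg t i * x i)) (fun i => hfm _) (fun i hi => ?_) (fun i hi => ?_),
      withDensity_apply _ hA]
    · rw [finSeq_apply, if_pos hi]
      exact gaussianReal_eq_withDensity_exp hσ _
    · rw [finSeq_apply, if_neg hi]; rfl
  -- Subsets `t` encode sign patterns. Expanding a product of sums over `F` turns the sum of all
  -- likelihood ratios into the product of the symmetrised densities.
  have hsum : ∑ t ∈ F.powerset, obsLaw σ (finSeq F fun i => sg t i * x i) A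
      = 2 ^ F.card * I := by
    simp_rw [hdens]
    rw [← lintegral_finsetSum, hI, ← lintegral_const_mul]
    · refine lintegral_congr fun y => ?_
      have h1 : ∀ t ∈ F.powerset, ∏ i ∈ F, f (sg t i * x i) (y i)
          = (∏ i ∈ t, f (x i) (y i)) * ∏ i ∈ F \ t, f (-x i) (y i) := fun t ht => by
        have h2 := Finset.prod_piecewise F t (fun i => f (x i) (y i)) fun i => f (-x i) (y i)
        rw [Finset.inter_eq_right.2 (Finset.mem_powerset.1 ht)] at h2
        rw [← h2]
        refine Finset.prod_congr rfl fun i _ => ?_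
        by_cases hi : i ∈ t <;> simp [hsg, hi]
      rw [Finset.sum_congr rfl h1, ← Finset.prod_add, ← Finset.prod_const,
        ← Finset.prod_mul_distrib]
      exact Finset.prod_congr rfl fun i _ => ofReal_exp_add_ofReal_exp_neg σ (x i) (y i)
    · exact Finset.measurable_prod _ fun i _ =>
        ((measurable_symmDensity σ _).comp (measurable_pi_apply i)).ennreal_ofReal
    · exact fun t _ => Finset.measurable_prod _ fun i _ => (hfm _).comp (measurable_pi_apply i)
  obtain ⟨t, -, hmax⟩ := Finset.exists_max_image F.powerset
    (fun t => obsLaw σ (finSeq F fun i => sg t i * x i) A) ⟨∅, Finset.empty_mem_powerset F⟩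
  refine ⟨sg t, fun i => by simp only [hsg]; split_ifs <;> simp, ?_⟩
  have h1 := Finset.sum_le_card_nsmul _ _ _ hmax
  rw [hsum, Finset.card_powerset, nsmul_eq_mul, Nat.cast_pow, Nat.cast_ofNat] at h1
  exact (ENNReal.mul_le_mul_iff_right (by positivity) (by finiteness)).1 h1

theorem lintegral_prod_inv_symmDensity_le {σ : ℝ} (hσ : 0 < σ) (F : Finset ι) (x : ι → ℝ)
    (hx : ∑ i ∈ F, x i ^ 4 ≤ σ ^ 4) :
    ∫⁻ y, ∏ i ∈ F, ENNReal.ofReal (symmDensity σ (x i) (y i))⁻¹ ∂obsLaw σ (0 : SeqSpace ι)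
      ≤ ENNReal.ofReal (Real.exp 10) := by
  have hm : ∀ i, Measurable fun y => ENNReal.ofReal (symmDensity σ (x i) y)⁻¹ := fun i =>
    (measurable_symmDensity σ _).inv.ennreal_ofReal
  have hind := lintegral_prod_eq_prod_lintegral_of_indepFun (μ := obsLaw σ (0 : SeqSpace ι)) F
    (fun i y => ENNReal.ofReal (symmDensity σ (x i) (y i))⁻¹) (iIndepFun_infinitePi hm)
    fun i => (hm i).comp (measurable_pi_apply i)
  rw [hind]
  have hle : ∀ i ∈ F, ∫⁻ y, ENNReal.ofReal (symmDensity σ (x i) (y i))⁻¹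
      ∂obsLaw σ (0 : SeqSpace ι) ≤ ENNReal.ofReal (Real.exp (10 * (x i ^ 4 / σ ^ 4))) := by
    intro i hi
    have h1 := (measurePreserving_eval_infinitePi
      (fun i => gaussianReal ((0 : SeqSpace ι) i) (Real.toNNReal (σ ^ 2))) i).lintegral_comp (hm i)
    refine le_trans (le_of_eq h1) (lintegral_inv_symmDensity_le hσ ?_)
    exact (Finset.single_le_sum (f := fun i => x i ^ 4) (fun i _ => by positivity) hi).trans hx
  refine (Finset.prod_le_prod' hle).trans ?_
  rw [← ENNReal.ofReal_prod_of_nonneg fun i _ => (Real.exp_pos _).le, ← Real.exp_sum,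
    ← Finset.mul_sum, ← Finset.sum_div]
  refine ENNReal.ofReal_le_ofReal (Real.exp_le_exp.2 ?_)
  have := (div_le_one (by positivity : 0 < σ ^ 4)).2 hx
  linarith

/-- A set which is likely under pure noise stays likely for some signs of a weak signal. -/
theorem exists_signs_obsLaw_ge {σ : ℝ} (hσ : 0 < σ) (F : Finset ι) (x : ι → ℝ)
    (hx : ∑ i ∈ F, x i ^ 4 ≤ σ ^ 4) {A : Set (ι → ℝ)} (hA : MeasurableSet A) {p : ℝ} (hp : 0 < p)
    (hpA : ENNReal.ofReal p ≤ obsLaw σ (0 : SeqSpace ι) A) :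
    ∃ ε : ι → ℝ, (∀ i, ε i = 1 ∨ ε i = -1) ∧
      ENNReal.ofReal (p ^ 2 / Real.exp 10) ≤ obsLaw σ (finSeq F fun i => ε i * x i) A := by
  obtain ⟨ε, hε, hle⟩ := exists_signs_lintegral_symmDensity_le hσ F x hA
  refine ⟨ε, hε, le_trans ?_ hle⟩
  set I := ∫⁻ y in A, ∏ i ∈ F, ENNReal.ofReal (symmDensity σ (x i) (y i))
    ∂obsLaw σ (0 : SeqSpace ι) with hI
  have hE : 0 < Real.exp 10 := Real.exp_pos _
  -- Cauchy-Schwarz is used as `2 ≤ l * L + 1 / (l * L)` integrated over `A`; this `l` makes the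
  -- second term at most `p`.
  set l : ℝ := Real.exp 10 / p with hl
  have hl0 : 0 < l := by positivity
  have hpt : ∀ y : ι → ℝ, (2 : ℝ≥0∞)
      ≤ ENNReal.ofReal l * ∏ i ∈ F, ENNReal.ofReal (symmDensity σ (x i) (y i))
        + ENNReal.ofReal l⁻¹ * ∏ i ∈ F, ENNReal.ofReal (symmDensity σ (x i) (y i))⁻¹ := by
    intro y
    rw [← ENNReal.ofReal_prod_of_nonneg fun i _ => (symmDensity_pos σ _ _).le,
      ← ENNReal.ofReal_prod_of_nonneg fun i _ => (inv_pos.2 (symmDensity_pos σ _ _)).le,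
      ← ENNReal.ofReal_mul hl0.le, ← ENNReal.ofReal_mul (inv_pos.2 hl0).le,
      Finset.prod_inv_distrib, ← mul_inv]
    have hg : 0 < l * ∏ i ∈ F, symmDensity σ (x i) (y i) :=
      mul_pos hl0 (Finset.prod_pos fun i _ => symmDensity_pos σ _ _)
    generalize l * ∏ i ∈ F, symmDensity σ (x i) (y i) = g at hg
    rw [← ENNReal.ofReal_add hg.le (inv_pos.2 hg).le, ← ENNReal.ofReal_ofNat 2]
    refine ENNReal.ofReal_le_ofReal ?_
    have : g + g⁻¹ - 2 = (g - 1) ^ 2 / g := by field_simp; ring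
    have : 0 ≤ (g - 1) ^ 2 / g := by positivity
    linarith
  have hgm : Measurable fun y : ι → ℝ =>
      ∏ i ∈ F, ENNReal.ofReal (symmDensity σ (x i) (y i)) :=
    Finset.measurable_prod _ fun i _ =>
      ((measurable_symmDensity σ _).comp (measurable_pi_apply i)).ennreal_ofReal
  have hgm' : Measurable fun y : ι → ℝ =>
      ∏ i ∈ F, ENNReal.ofReal (symmDensity σ (x i) (y i))⁻¹ :=
    Finset.measurable_prod _ fun i _ =>
      ((measurable_symmDensity σ _).inv.comp (measurable_pi_apply i)).ennreal_ofReal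
  have hmain : 2 * ENNReal.ofReal p ≤ ENNReal.ofReal l * I + ENNReal.ofReal p := by
    calc 2 * ENNReal.ofReal p ≤ 2 * obsLaw σ (0 : SeqSpace ι) A := by gcongr
      _ = ∫⁻ _y in A, 2 ∂obsLaw σ (0 : SeqSpace ι) := by rw [setLIntegral_const]
      _ ≤ _ := lintegral_mono hpt
      _ = ENNReal.ofReal l * I + ENNReal.ofReal l⁻¹ *
          ∫⁻ y in A, ∏ i ∈ F, ENNReal.ofReal (symmDensity σ (x i) (y i))⁻¹
            ∂obsLaw σ (0 : SeqSpace ι) := by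
          rw [lintegral_add_left (hgm.const_mul _), lintegral_const_mul _ hgm,
            lintegral_const_mul _ hgm']
      _ ≤ ENNReal.ofReal l * I + ENNReal.ofReal l⁻¹ * ENNReal.ofReal (Real.exp 10) := by
          gcongr
          exact (setLIntegral_le_lintegral _ _).trans (lintegral_prod_inv_symmDensity_le hσ F x hx)
      _ = _ := by
          rw [← ENNReal.ofReal_mul (inv_pos.2 hl0).le, hl, inv_div, div_mul_cancel₀ _ hE.ne']
  rw [two_mul] at hmain
  have h1 := (ENNReal.add_le_add_iff_right ENNReal.ofReal_ne_top).1 hmain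
  have h2 : ENNReal.ofReal p = ENNReal.ofReal l * ENNReal.ofReal (p ^ 2 / Real.exp 10) := by
    rw [← ENNReal.ofReal_mul hl0.le, hl]
    congr 1
    field_simp
  rw [h2] at h1
  exact (ENNReal.mul_le_mul_iff_right (ENNReal.ofReal_pos.2 hl0).ne' ENNReal.ofReal_ne_top).1 h1

/-- A weak signal in an orthosymmetric set is missed by every level-`α` test. -/
theorem lt_typeTwoError_of_sum_pow_four_le {K : Set (SeqSpace ι)} (ho : IsOrthosymmetric K)
    {α δ σ ρ : ℝ} (hα0 : 0 ≤ α) (hα : α < 1) (hσ : 0 < σ)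
    (hδ : δ < (1 - α) ^ 2 / Real.exp 10) (F : Finset ι) (x : ι → ℝ) (hxK : finSeq F x ∈ K)
    (hx : ∑ i ∈ F, x i ^ 4 ≤ σ ^ 4) (hρ : ρ ≤ ‖finSeq F x‖) {φ : (ι → ℝ) → Fin 2}
    (hφ : IsLevelTest α σ φ) : ENNReal.ofReal δ < typeTwoError φ K σ ρ := by
  classical
  have hA : MeasurableSet {y | φ y = 0} := hφ.1 (measurableSet_singleton 0)
  have hp : ENNReal.ofReal (1 - α) ≤ obsLaw σ (0 : SeqSpace ι) {y | φ y = 0} := by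
    have hcompl : {y | φ y = 0} = {y | φ y = 1}ᶜ := by
      ext y
      simp only [Set.mem_ofPred_eq, Set.mem_compl_iff]
      omega
    have hB : MeasurableSet {y | φ y = 1} := hφ.1 (measurableSet_singleton 1)
    rw [hcompl, prob_compl_eq_one_sub hB, ← ENNReal.ofReal_one]
    rw [ENNReal.ofReal_sub _ hα0]
    exact tsub_le_tsub_left hφ.2 _
  obtain ⟨ε, hε, hge⟩ := exists_signs_obsLaw_ge hσ F x hx hA (sub_pos.2 hα) hp
  have hmem : finSeq F (fun i => ε i * x i) ∈ K := ho _ hxK _ fun i => by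
    rw [finSeq_apply, finSeq_apply]
    rcases hε i with h | h <;> split_ifs <;> simp [h]
  have hnorm : ‖finSeq F fun i => ε i * x i‖ = ‖finSeq F x‖ := by
    rw [← sq_eq_sq₀ (norm_nonneg _) (norm_nonneg _), norm_sq_finSeq, norm_sq_finSeq]
    refine Finset.sum_congr rfl fun i _ => ?_
    rcases hε i with h | h <;> simp [h]
  have h1 : ENNReal.ofReal δ < ENNReal.ofReal ((1 - α) ^ 2 / Real.exp 10) :=
    (ENNReal.ofReal_lt_ofReal_iff (by have := sub_pos.2 hα; positivity)).2 hδ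
  refine h1.trans_le (hge.trans ?_)
  exact le_iSup₂_of_le (f := fun μ (_ : μ ∈ {μ : SeqSpace ι | μ ∈ K ∧ ρ ≤ ‖μ‖}) =>
    obsLaw σ μ {y | φ y = 0}) _ ⟨hmem, hnorm ▸ hρ⟩ le_rfl

end LowerBound

/-! ### The energy test -/

section UpperBound

theorem integrable_pow_gaussianReal (m : ℝ) (v : NNReal) (n : ℕ) :
    Integrable (fun x => x ^ n) (gaussianReal m v) := by
  rcases Nat.eq_zero_or_pos n with rfl | hn
  · simp
  · have h := (memLp_id_gaussianReal' (μ := m) (v := v) n (by simp)).integrable_norm_pow hn.ne'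
    refine h.mono' (by fun_prop) (ae_of_all _ fun x => ?_)
    simp

/-- A crude bound from `y ^ 4 / 4! ≤ exp |y|` suffices, as only the order `σ ^ 4` matters. -/
theorem integral_pow_four_gaussianReal_le {σ : ℝ} (hσ : 0 < σ) :
    ∫ x, x ^ 4 ∂gaussianReal 0 (Real.toNNReal (σ ^ 2)) ≤ 96 * σ ^ 4 := by
  have hint : ∀ c : ℝ, Integrable (fun x => Real.exp (c * x))
      (gaussianReal 0 (Real.toNNReal (σ ^ 2))) := fun c => integrable_exp_mul_gaussianReal c
  have hpt : ∀ x : ℝ, x ^ 4 ≤ 24 * σ ^ 4 * (Real.exp (σ⁻¹ * x) + Real.exp (-σ⁻¹ * x)) := fun x => by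
    have h1 := Real.pow_div_factorial_le_exp _ (abs_nonneg (σ⁻¹ * x)) 4
    have h2 : Real.exp |σ⁻¹ * x| ≤ Real.exp (σ⁻¹ * x) + Real.exp (-σ⁻¹ * x) := by
      rw [neg_mul]
      rcases abs_cases (σ⁻¹ * x) with ⟨h, -⟩ | ⟨h, -⟩ <;> rw [h]
      · linarith [Real.exp_pos (-(σ⁻¹ * x))]
      · linarith [Real.exp_pos (σ⁻¹ * x)]
    have h3 : x ^ 4 = 24 * σ ^ 4 * (|σ⁻¹ * x| ^ 4 / (Nat.factorial 4 : ℕ)) := by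
      rw [Even.pow_abs (by decide)]
      simp only [Nat.factorial]
      push_cast
      field_simp
    rw [h3]
    exact mul_le_mul_of_nonneg_left (h1.trans h2) (by positivity)
  calc ∫ x, x ^ 4 ∂gaussianReal 0 (Real.toNNReal (σ ^ 2))
      ≤ ∫ x, 24 * σ ^ 4 * (Real.exp (σ⁻¹ * x) + Real.exp (-σ⁻¹ * x))
        ∂gaussianReal 0 (Real.toNNReal (σ ^ 2)) :=
        integral_mono (integrable_pow_gaussianReal _ _ 4)
          (((hint _).add (hint _)).const_mul _) hpt
    _ = 48 * σ ^ 4 * Real.exp (1 / 2) := by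
        rw [integral_const_mul, integral_add (hint _) (hint _), integral_exp_mul_gaussianReal,
          integral_exp_mul_gaussianReal]
        have : σ ^ 2 * σ⁻¹ ^ 2 = 1 := by field_simp
        rw [neg_sq, this]; ring
    _ ≤ 48 * σ ^ 4 * 2 := by
        gcongr
        have h1 := Real.abs_exp_sub_one_le (x := 1 / 2) (by norm_num [abs_le])
        rw [abs_le, abs_of_nonneg (by norm_num)] at h1
        linarith [h1.2]
    _ = _ := by ring

theorem memLp_sq_gaussianReal (m : ℝ) (v : NNReal) :
    MemLp (fun x => x ^ 2) 2 (gaussianReal m v) := by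
  rw [memLp_two_iff_integrable_sq (by fun_prop)]
  simpa [← pow_mul] using integrable_pow_gaussianReal m v 4

theorem integral_sq_gaussianReal (m : ℝ) (v : NNReal) :
    ∫ x, x ^ 2 ∂gaussianReal m v = m ^ 2 + v := by
  have h := variance_eq_sub (memLp_id_gaussianReal' (μ := m) (v := v) 2 (by simp))
  rw [variance_id_gaussianReal] at h
  simp only [id, Pi.pow_apply, integral_id_gaussianReal] at h
  linarith

theorem variance_sq_gaussianReal_le {σ : ℝ} (hσ : 0 < σ) (m : ℝ) :
    Var[fun x => x ^ 2; gaussianReal m (Real.toNNReal (σ ^ 2))]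
      ≤ 8 * m ^ 2 * σ ^ 2 + 192 * σ ^ 4 := by
  set v := Real.toNNReal (σ ^ 2) with hv
  have hvc : (v : ℝ) = σ ^ 2 := Real.coe_toNNReal _ (sq_nonneg _)
  have hmap : gaussianReal m v = (gaussianReal 0 v).map (· + m) := by
    rw [gaussianReal_map_add_const, zero_add]
  have hi := integrable_pow_gaussianReal 0 v
  calc Var[fun x => x ^ 2; gaussianReal m v]
      = Var[fun x => x ^ 2 - m ^ 2; gaussianReal m v] :=
        (variance_sub_const (by fun_prop) _).symm
    _ ≤ ∫ x, (x ^ 2 - m ^ 2) ^ 2 ∂gaussianReal m v := variance_le_expectation_sq (by fun_prop)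
    _ = ∫ x, ((x + m) ^ 2 - m ^ 2) ^ 2 ∂gaussianReal 0 v := by
        rw [hmap, integral_map (by fun_prop) (by fun_prop)]
    _ ≤ ∫ x, (8 * m ^ 2 * x ^ 2 + 2 * x ^ 4) ∂gaussianReal 0 v := by
        refine integral_mono ?_ (((hi 2).const_mul _).add ((hi 4).const_mul _)) fun x => ?_
        · have h : (fun x : ℝ => ((x + m) ^ 2 - m ^ 2) ^ 2)
              = fun x => x ^ 4 + 4 * m * x ^ 3 + 4 * m ^ 2 * x ^ 2 := by funext x; ring
          rw [h]
          exact ((hi 4).add ((hi 3).const_mul _)).add ((hi 2).const_mul _)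
        · have h0 := sq_nonneg (x ^ 2 - 2 * m * x)
          have h : 8 * m ^ 2 * x ^ 2 + 2 * x ^ 4 - ((x + m) ^ 2 - m ^ 2) ^ 2
              = (x ^ 2 - 2 * m * x) ^ 2 := by ring
          simp only
          linarith
    _ = 8 * m ^ 2 * σ ^ 2 + 2 * ∫ x, x ^ 4 ∂gaussianReal 0 v := by
        rw [integral_add ((hi 2).const_mul _) ((hi 4).const_mul _), integral_const_mul,
          integral_const_mul, integral_sq_gaussianReal, hvc]
        ring
    _ ≤ _ := by linarith [integral_pow_four_gaussianReal_le hσ]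

variable {ι : Type}

/-- Chebyshev's inequality for the energy of the observation in the coordinates `S`. -/
theorem obsLaw_energy_deviation_le {σ : ℝ} (hσ : 0 < σ) (μ : SeqSpace ι) (S : Finset ι) {c : ℝ}
    (hc : 0 < c) :
    obsLaw σ μ {x | c ≤ |∑ i ∈ S, x i ^ 2 - (∑ i ∈ S, μ i ^ 2 + S.card * σ ^ 2)|}
      ≤ ENNReal.ofReal ((8 * (∑ i ∈ S, μ i ^ 2) * σ ^ 2 + 192 * S.card * σ ^ 4) / c ^ 2) := by
  classical
  set X : ι → (ι → ℝ) → ℝ := fun i x => x i ^ 2 with hX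
  have hmp : ∀ i, MeasurePreserving (fun x : ι → ℝ => x i) (obsLaw σ μ)
      (gaussianReal (μ i) (Real.toNNReal (σ ^ 2))) := fun i =>
    measurePreserving_eval_infinitePi
      (fun i => gaussianReal (μ i) (Real.toNNReal (σ ^ 2))) i
  have hL : ∀ i, MemLp (X i) 2 (obsLaw σ μ) := fun i =>
    (memLp_sq_gaussianReal _ _).comp_measurePreserving (hmp i)
  have hind : iIndepFun X (obsLaw σ μ) :=
    iIndepFun_infinitePi (X := fun _ (y : ℝ) => y ^ 2) fun _ => by fun_prop
  have hmean : ∀ i, ∫ x, X i x ∂obsLaw σ μ = μ i ^ 2 + σ ^ 2 := fun i => by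
    have h1 := integral_map (μ := obsLaw σ μ) (φ := fun x : ι → ℝ => x i)
      (f := fun y : ℝ => y ^ 2) (hmp i).measurable.aemeasurable (by fun_prop)
    rw [(hmp i).map_eq, integral_sq_gaussianReal, Real.coe_toNNReal _ (sq_nonneg _)] at h1
    exact h1.symm
  have hvar : ∀ i, Var[X i; obsLaw σ μ] ≤ 8 * μ i ^ 2 * σ ^ 2 + 192 * σ ^ 4 := fun i => by
    have h1 := variance_map (μ := obsLaw σ μ) (Y := fun x : ι → ℝ => x i)
      (X := fun y : ℝ => y ^ 2) (by fun_prop) (hmp i).measurable.aemeasurable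
    rw [(hmp i).map_eq] at h1
    exact h1.symm.le.trans (variance_sq_gaussianReal_le hσ _)
  have hV : Var[∑ i ∈ S, X i; obsLaw σ μ]
      ≤ 8 * (∑ i ∈ S, μ i ^ 2) * σ ^ 2 + 192 * S.card * σ ^ 4 := by
    rw [IndepFun.variance_sum (fun i _ => hL i) fun i _ j _ hij => hind.indepFun hij]
    refine (Finset.sum_le_sum fun i _ => hvar i).trans (le_of_eq ?_)
    rw [Finset.sum_add_distrib, Finset.sum_const, nsmul_eq_mul, Finset.mul_sum, Finset.sum_mul]
    ring
  have hE : (obsLaw σ μ)[∑ i ∈ S, X i] = ∑ i ∈ S, μ i ^ 2 + S.card * σ ^ 2 := by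
    simp only [Finset.sum_apply]
    rw [integral_finsetSum _ fun i _ => (hL i).integrable one_le_two]
    simp_rw [hmean]
    rw [Finset.sum_add_distrib, Finset.sum_const, nsmul_eq_mul]
  have h := meas_ge_le_variance_div_sq (memLp_finsetSum' S fun i _ => hL i) hc
  rw [hE] at h
  simp only [Finset.sum_apply] at h
  refine h.trans (ENNReal.ofReal_le_ofReal ?_)
  gcongr

/-- The test rejecting for large energy in the coordinates `S`. -/
noncomputable def energyTest (S : Finset ι) (b : ℝ) (x : ι → ℝ) : Fin 2 :=
  if b ≤ ∑ i ∈ S, x i ^ 2 then 1 else 0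

theorem measurable_energyTest (S : Finset ι) (b : ℝ) : Measurable (energyTest S b) :=
  Measurable.ite (measurableSet_le measurable_const (by fun_prop)) measurable_const
    measurable_const

theorem isLevelTest_energyTest {α σ r : ℝ} (hα : 0 < α) (hα1 : α < 1) (hσ : 0 < σ) (hr : 0 < r)
    {S : Finset ι} (hS : S.card ≤ 2 * r ^ 4) :
    IsLevelTest α σ (energyTest S (S.card * σ ^ 2 + 384 / α * (r ^ 2 * σ ^ 2))) := by
  refine ⟨measurable_energyTest _ _, ?_⟩
  -- Under the null the variance is at most `192 * (2 * r ^ 4) * σ ^ 4`, whence 384.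
  have hc : 0 < 384 / α * (r ^ 2 * σ ^ 2) := by positivity
  refine le_trans (measure_mono fun x hx => ?_)
    ((obsLaw_energy_deviation_le hσ 0 S hc).trans (ENNReal.ofReal_le_ofReal ?_))
  · have h1 : S.card * σ ^ 2 + 384 / α * (r ^ 2 * σ ^ 2) ≤ ∑ i ∈ S, x i ^ 2 := by
      by_contra hcon
      simp [energyTest, hcon] at hx
    have h2 : ∑ i ∈ S, (0 : SeqSpace ι) i ^ 2 = 0 := Finset.sum_eq_zero fun i _ => by simp
    rw [Set.mem_ofPred_eq, h2]
    exact le_abs.2 (Or.inl (by linarith))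
  · have h2 : ∑ i ∈ S, (0 : SeqSpace ι) i ^ 2 = 0 := Finset.sum_eq_zero fun i _ => by simp
    rw [h2, div_le_iff₀ (by positivity)]
    have h3 : α * (384 / α * (r ^ 2 * σ ^ 2)) ^ 2 = 384 ^ 2 / α * (r ^ 4 * σ ^ 4) := by
      field_simp
    have h4 : (384 : ℝ) ≤ 384 ^ 2 / α := by
      rw [le_div_iff₀ hα]; nlinarith
    have h5 : S.card * σ ^ 4 ≤ 2 * r ^ 4 * σ ^ 4 := by gcongr
    have h6 : 384 * (r ^ 4 * σ ^ 4) ≤ 384 ^ 2 / α * (r ^ 4 * σ ^ 4) := by gcongr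
    rw [h3]
    linarith

theorem obsLaw_energyTest_eq_zero_le {α δ σ r : ℝ} (hα : 0 < α) (hα1 : α < 1) (hδ : 0 < δ)
    (hσ : 0 < σ) (hr : 1 ≤ r) {S : Finset ι} (hS : S.card ≤ 2 * r ^ 4) {μ : SeqSpace ι}
    (hμ : (768 / α + 1568 / δ) * (r ^ 2 * σ ^ 2) ≤ ∑ i ∈ S, μ i ^ 2) :
    obsLaw σ μ {x | energyTest S (S.card * σ ^ 2 + 384 / α * (r ^ 2 * σ ^ 2)) x = 0}
      ≤ ENNReal.ofReal δ := by
  set m := ∑ i ∈ S, μ i ^ 2 with hm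
  have hu : 0 < r ^ 2 * σ ^ 2 := by positivity
  set u := r ^ 2 * σ ^ 2 with hudef
  have hm1 : 768 / α * u ≤ m := by
    have : 0 ≤ 1568 / δ * u := by positivity
    linarith
  have hm2 : 1568 * u ≤ δ * m := by
    have h0 : 0 ≤ 768 / α * u := by positivity
    have h1 : 1568 / δ * u ≤ m := by linarith
    calc 1568 * u = δ * (1568 / δ * u) := by field_simp
      _ ≤ _ := by gcongr
  have hm3 : u ≤ m := by
    refine le_trans ?_ hm1
    have : 1 ≤ 768 / α := by rw [le_div_iff₀ hα]; linarith
    nlinarith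
  have hm0 : 0 < m := hu.trans_le hm3
  -- The threshold excess is at most `m / 2`, so acceptance forces a deviation of `m / 2`. The
  -- variance is at most `(8 + 384) * m * u`, and `1568 = 4 * 392`.
  refine le_trans (measure_mono fun x hx => ?_)
    ((obsLaw_energy_deviation_le hσ μ S (half_pos hm0)).trans (ENNReal.ofReal_le_ofReal ?_))
  · have h1 : ∑ i ∈ S, x i ^ 2 < S.card * σ ^ 2 + 384 / α * u := by
      by_contra! hcon
      exact absurd hx (by simp [energyTest, hcon])
    rw [Set.mem_ofPred_eq, ← hm]
    have h2 : 768 / α * u = 2 * (384 / α * u) := by ring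
    exact le_abs.2 (Or.inr (by linarith))
  · rw [← hm, div_le_iff₀ (by positivity)]
    have h1 : σ ^ 2 ≤ u := by exact le_mul_of_one_le_left (sq_nonneg σ) (one_le_pow₀ hr)
    have h2 : S.card * σ ^ 4 ≤ 2 * u ^ 2 := by
      calc S.card * σ ^ 4 ≤ 2 * r ^ 4 * σ ^ 4 := by gcongr
        _ = 2 * u ^ 2 := by rw [hudef]; ring
    have h3 : m * σ ^ 2 ≤ m * u := by gcongr
    have h4 : u * u ≤ m * u := by gcongr
    have h5 : 1568 * u * m ≤ δ * m * m := by gcongr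
    nlinarith

end UpperBound

/-! ### Bounds on the critical radius -/

section CriticalRadius

variable {ι : Type} {K : Set (SeqSpace ι)}

theorem ofReal_le_criticalRadius {α δ σ R : ℝ}
    (h : ∀ φ : (ι → ℝ) → Fin 2, IsLevelTest α σ φ → ∀ ρ : ℝ, 0 < ρ → ρ < R →
      ENNReal.ofReal δ < typeTwoError φ K σ ρ) : ENNReal.ofReal R ≤ criticalRadius K α δ σ := by
  refine le_iInf₂ fun φ hφ => le_iInf₂ fun ρ hρ => ENNReal.ofReal_le_ofReal ?_
  by_contra! hlt
  exact absurd hρ.2 (not_le.2 (h φ hφ ρ hρ.1 hlt))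

theorem criticalRadius_le_ofReal {α δ σ ρ : ℝ} (hρ : 0 < ρ) {φ : (ι → ℝ) → Fin 2}
    (hφ : IsLevelTest α σ φ) (h : typeTwoError φ K σ ρ ≤ ENNReal.ofReal δ) :
    criticalRadius K α δ σ ≤ ENNReal.ofReal ρ :=
  iInf₂_le_of_le φ hφ (iInf₂_le_of_le ρ ⟨hρ, h⟩ le_rfl)

theorem criticalRadius_ge_of_lt_kolmogorovWidth (hK : IsQCO K)
    (hlim : Infinite ι → Tendsto (fun k : ℕ => kolmogorovWidth K k) atTop (𝓝 0))
    {α δ σ : ℝ} (hα0 : 0 ≤ α) (hα : α < 1) (hδ : δ < (1 - α) ^ 2 / Real.exp 10) (hσ : 0 < σ)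
    {j : ℕ} (hj : 1 ≤ j) (hcard : (j : ℕ∞) ≤ ENat.card ι)
    (h : ENNReal.ofReal ((j : ℝ) ^ (1 / 4 : ℝ) * σ) < kolmogorovWidth K (j - 1)) :
    ENNReal.ofReal (1 / 2 * ((j : ℝ) ^ (1 / 4 : ℝ) * σ)) ≤ criticalRadius K α δ σ := by
  obtain ⟨F, x, hxK, hx2, hx4⟩ := exists_least_favourable hK hlim hj hcard hσ h
  refine ofReal_le_criticalRadius fun φ hφ ρ _ hρR => ?_
  refine lt_typeTwoError_of_sum_pow_four_le hK.2 hα0 hα hσ hδ F x hxK hx4 ?_ hφ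
  refine hρR.le.trans (abs_le_of_sq_le_sq' ?_ (norm_nonneg _)).2
  rw [norm_sq_finSeq, hx2]

theorem criticalRadius_le_of_kolmogorovWidth_le (hK : IsQCO K) {α δ σ : ℝ} (hα : 0 < α)
    (hα1 : α < 1) (hδ : 0 < δ) (hσ : 0 < σ) {j : ℕ} (hj : 1 ≤ j)
    (h : kolmogorovWidth K j ≤ ENNReal.ofReal (((j : ℝ) + 1) ^ (1 / 4 : ℝ) * σ)) :
    criticalRadius K α δ σ
      ≤ ENNReal.ofReal ((768 / α + 1568 / δ + 32) * ((j : ℝ) ^ (1 / 4 : ℝ) * σ)) := by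
  have hj1 : (1 : ℝ) ≤ j := by exact_mod_cast hj
  have hj0 : (0 : ℝ) < j := by linarith
  set r : ℝ := (j : ℝ) ^ (1 / 4 : ℝ) with hr
  have hr1 : 1 ≤ r := Real.one_le_rpow hj1 (by norm_num)
  have hr4 : r ^ 4 = j := by
    rw [hr, ← Real.rpow_natCast, ← Real.rpow_mul hj0.le]; norm_num
  have hr0 : 0 < r := by linarith
  have hjr : ((j : ℝ) + 1) ^ (1 / 4 : ℝ) ≤ 2 * r := by
    calc ((j : ℝ) + 1) ^ (1 / 4 : ℝ) ≤ ((2 * r) ^ 4) ^ (1 / 4 : ℝ) := by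
          refine Real.rpow_le_rpow (by linarith) ?_ (by norm_num)
          rw [mul_pow, hr4]; linarith
      _ = 2 * r := by
          rw [← Real.rpow_natCast, ← Real.rpow_mul (by linarith)]; norm_num
  -- Doubling `2 * r * σ` gives the strict inequality needed to pick a subspace. The resulting error
  -- `2 * (4 * r * σ) ^ 2` is the 32 in the constant.
  have hlt : kolmogorovWidth K j < ENNReal.ofReal (4 * r * σ) := by
    refine h.trans_lt ((ENNReal.ofReal_lt_ofReal_iff (by positivity)).2 ?_)
    have := mul_le_mul_of_nonneg_right hjr hσ.le
    have : 0 < r * σ := by positivity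
    linarith
  obtain ⟨S, hS, hSK⟩ := exists_approx_of_kolmogorovWidth_lt hK.1.1 hK.2 (by positivity) hlt
  have hS' : (S.card : ℝ) ≤ 2 * r ^ 4 := by rw [hr4]; exact_mod_cast hS
  have hC1 : 32 ≤ 768 / α + 1568 / δ + 32 := by
    have : 0 ≤ 768 / α + 1568 / δ := by positivity
    linarith
  set C := 768 / α + 1568 / δ + 32 with hC
  have hC0 : 0 < C := by linarith
  refine criticalRadius_le_ofReal (by positivity) (isLevelTest_energyTest hα hα1 hσ hr0 hS')
    (iSup₂_le fun μ hμ => obsLaw_energyTest_eq_zero_le hα hα1 hδ hσ hr1 hS' ?_)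
  have h1 := hSK μ hμ.1
  have h2 : (C * (r * σ)) ^ 2 ≤ ‖μ‖ ^ 2 := pow_le_pow_left₀ (by positivity) hμ.2 2
  have h3 : C * (r ^ 2 * σ ^ 2) ≤ (C * (r * σ)) ^ 2 := by
    have h4 : 0 < r ^ 2 * σ ^ 2 := by positivity
    have h5 : (C * (r * σ)) ^ 2 = C * (C * (r ^ 2 * σ ^ 2)) := by ring
    rw [h5]
    exact mul_le_mul_of_nonneg_left (le_mul_of_one_le_left h4.le (by linarith)) hC0.le
  have h6 : 768 / α + 1568 / δ = C - 32 := by rw [hC]; ring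
  rw [h6]
  nlinarith

/-- A point with `ρ < ‖θ‖ ≤ σ` has `∑ θ i ^ 4 ≤ σ ^ 2 * ∑ θ i ^ 2 ≤ σ ^ 4`, so a finite truncation
still longer than `ρ` is undetectable. -/
theorem lt_typeTwoError_of_lt_kolmogorovWidth_zero (hK : IsQCO K) {α δ σ ρ : ℝ} (hα0 : 0 ≤ α)
    (hα : α < 1) (hδ : δ < (1 - α) ^ 2 / Real.exp 10) (hσ : 0 < σ)
    (h : kolmogorovWidth K 0 ≤ ENNReal.ofReal σ) (hρ : 0 < ρ)
    (hρK : ENNReal.ofReal ρ < kolmogorovWidth K 0) {φ : (ι → ℝ) → Fin 2}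
    (hφ : IsLevelTest α σ φ) : ENNReal.ofReal δ < typeTwoError φ K σ ρ := by
  rw [kolmogorovWidth_zero] at h hρK
  simp only [lt_iSup_iff] at hρK
  obtain ⟨θ, hθ, hlt⟩ := hρK
  have hθσ : ‖θ‖ ≤ σ := (ENNReal.ofReal_le_ofReal_iff hσ.le).1
    ((le_iSup₂_of_le (f := fun θ (_ : θ ∈ K) => ENNReal.ofReal ‖θ‖) θ hθ le_rfl).trans h)
  have hρθ : ρ < ‖θ‖ := (ENNReal.ofReal_lt_ofReal_iff_of_nonneg hρ.le).1 hlt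
  obtain ⟨F, hF⟩ : ∃ F : Finset ι, ρ ^ 2 < ∑ i ∈ F, θ i ^ 2 :=
    ((hasSum_sq_norm θ).eventually
      (lt_mem_nhds (pow_lt_pow_left₀ hρθ hρ.le two_ne_zero))).exists
  refine lt_typeTwoError_of_sum_pow_four_le hK.2 hα0 hα hσ hδ F θ
    (finSeq_self_mem hK.1.1 hK.2 hθ F) ?_ ?_ hφ
  · have hsq : ∀ i ∈ F, θ i ^ 4 ≤ σ ^ 2 * θ i ^ 2 := fun i hi => by
      have h1 : θ i ^ 2 ≤ σ ^ 2 := (Finset.single_le_sum (f := fun i => θ i ^ 2)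
        (fun i _ => sq_nonneg _) hi).trans ((sum_sq_le_norm_sq θ F).trans
          (pow_le_pow_left₀ (norm_nonneg _) hθσ 2))
      nlinarith [sq_nonneg (θ i)]
    refine (Finset.sum_le_sum hsq).trans ?_
    rw [← Finset.mul_sum]
    have h2 := (sum_sq_le_norm_sq θ F).trans (pow_le_pow_left₀ (norm_nonneg _) hθσ 2)
    nlinarith [sq_nonneg σ]
  · refine (abs_le_of_sq_le_sq' ?_ (norm_nonneg _)).2
    rw [norm_sq_finSeq]
    exact hF.le

end CriticalRadius

theorem mainTheorem1 :
    ∃ c : ℝ, 0 < c ∧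
    ∀ α : ℝ, 0 < α → α < 1 →
    ∃ δ₀ : ℝ, 0 < δ₀ ∧
    ∀ δ : ℝ, 0 < δ → δ ≤ δ₀ →
    ∃ C : ℝ, 0 < C ∧
    ∀ (ι : Type) [Countable ι] (K : Set (SeqSpace ι)) (σ : ℝ),
      IsQCO K → 0 < σ →
      (Infinite ι → Tendsto (fun k : ℕ => kolmogorovWidth K k) atTop (𝓝 0)) →
      (∀ j : ℕ, 1 ≤ j → (j : ℕ∞) ≤ ENat.card ι →
        ENNReal.ofReal ((j : ℝ) ^ (1 / 4 : ℝ) * σ) < kolmogorovWidth K (j - 1) →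
        kolmogorovWidth K j ≤ ENNReal.ofReal (((j : ℝ) + 1) ^ (1 / 4 : ℝ) * σ) →
        ENNReal.ofReal (c * ((j : ℝ) ^ (1 / 4 : ℝ) * σ)) ≤ criticalRadius K α δ σ ∧
        criticalRadius K α δ σ ≤ ENNReal.ofReal (C * ((j : ℝ) ^ (1 / 4 : ℝ) * σ))) ∧
      (kolmogorovWidth K 0 ≤ ENNReal.ofReal σ →
        kolmogorovWidth K 0 ≤ criticalRadius K α δ σ ∧
        ∀ φ : (ι → ℝ) → Fin 2, IsLevelTest α σ φ →
          ∀ ρ : ℝ, 0 < ρ → ENNReal.ofReal ρ < kolmogorovWidth K 0 →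
            ENNReal.ofReal δ < typeTwoError φ K σ ρ) := by
  refine ⟨1 / 2, by norm_num, fun α hα hα1 => ?_⟩
  have h1α : 0 < 1 - α := sub_pos.2 hα1
  have hB : 0 < (1 - α) ^ 2 / Real.exp 10 := by positivity
  -- Halving turns `δ ≤ δ₀` into the strict bound that the lower bound requires.
  refine ⟨(1 - α) ^ 2 / Real.exp 10 / 2, half_pos hB, fun δ hδ hδ₀ => ?_⟩
  have hδB : δ < (1 - α) ^ 2 / Real.exp 10 := hδ₀.trans_lt (half_lt_self hB)
  refine ⟨768 / α + 1568 / δ + 32, by positivity, fun ι _ K σ hK hσ hlim => ⟨?_, fun h0 => ?_⟩⟩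
  · intro j hj hcard hlt hle
    exact ⟨criticalRadius_ge_of_lt_kolmogorovWidth hK hlim hα.le hα1 hδB hσ hj hcard hlt,
      criticalRadius_le_of_kolmogorovWidth_le hK hα hα1 hδ hσ hj hle⟩
  · have herr : ∀ φ : (ι → ℝ) → Fin 2, IsLevelTest α σ φ →
        ∀ ρ : ℝ, 0 < ρ → ENNReal.ofReal ρ < kolmogorovWidth K 0 →
          ENNReal.ofReal δ < typeTwoError φ K σ ρ := fun φ hφ ρ hρ hρK =>
      lt_typeTwoError_of_lt_kolmogorovWidth_zero hK hα.le hα1 hδB hσ h0 hρ hρK hφ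
    refine ⟨?_, herr⟩
    have hfin : kolmogorovWidth K 0 ≠ ⊤ := (h0.trans_lt ENNReal.ofReal_lt_top).ne
    rw [← ENNReal.ofReal_toReal hfin]
    exact ofReal_le_criticalRadius fun φ hφ ρ hρ hρR =>
      herr φ hφ ρ hρ ((ENNReal.ofReal_lt_iff_lt_toReal hρ.le hfin).2 hρR)
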